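/- **Setting.** Let $d\in\{2,3\}$, $k\ge 1$, $k'\in\{k,k-1\}$, $0\le k^*\le k$, $\gamma_0>0$, $N_0\in\mathbb N$, $\tau\in(0,1)$. Let $\Omega\subset\mathbb R^d$ be a bounded open set and $\Omega_h\subset\Omega$ a polygonal/polyhedral domain with boundary $\Gamma_h$, outer unit normal $\nu$, and a tessellation $\mathcal T_h$ into finitely many polygons/polyhedra $K$ of diameter $h_K$. For $d=2$, "face" means side of a polygon. Assume that each $K$ is star shaped with respect to all points of a ball of radius $\ge\gamma_0h_K$ and has at most $N_0$ faces and, if $d=3$, that each face $f$, of diameter $h_f$, is star shaped with respect to a disc of radius $\ge\gamma_0h_f$ and has at most $N_0$ edges. Let $\mathcal F^\partial$ be the set of faces lying on $\Gamma_h$, and for $f\in\mathcal F^\partial$ let $K(f)$ be the element having $f$ as a face and $\tilde h_f=h_{K(f)}$. On each $f\in\mathcal F^\partial$ a constant unit vector $\sigma$ with $\sigma\cdot\nu>0$ is given; $\delta(x)\ge 0$ is the smallest $t\ge0$ with $x+t\sigma\in\partial\Omega$. Assume $$\max_{f\in\mathcal F^\partial}\ \max_{x\in f}\ \delta(x)/\tilde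 h_f\le\tau.\qquad(1)$$ **Projections and spaces.** $\mathbb P_m$ denotes polynomials of degree $\le m$ ($\mathbb P_{-1}=\{0\}$). For $D=K$, or $D=f$ a face when $d=3$, $\Pi^{\nabla}_D v\in\mathbb P_k(D)$ is defined by $\int_D\nabla\Pi^\nabla_Dv\cdot\nabla w=\int_D\nabla v\cdot\nabla w$ for all $w\in\mathbb P_k(D)$ and $\int_{\partial D}\Pi_D^\nabla v=\int_{\partial D}v$; $\Pi^\nabla v|_K=\Pi^\nabla_K(v|_K)$. $\Pi^{0}_\partial$ is the $L^2(\Gamma_h)$-projection onto $\Lambda_h=\{\mu\in L^2(\Gamma_h):\mu|_f\in\mathbb P_{k'}(f)\ \forall f\in\mathcal F^\partial\}$. The local face space $V^f$ is $\mathbb P_k(f)$ if $d=2$; if $d=3$ it is the set of $v\in C^0(f)\cap H^1(f)$ with $v|_e\in\mathbb P_k(e)$ for every edge $e$ of $f$, $\Delta v\in\mathbb P_k(f)$, and $\int_f q\,v=\int_f q\,\Pi^\nabla_fv$ for all $q\in\mathcal M_k\setminus\mathcal M_{k-2}$, where $\mathcal M_{k-2}\subset\mathcal M_k$ are given bases of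 $\mathbb P_{k-2}(f)$ and $\mathbb P_k(f)$. Then $V^K=\{v\in H^1(K): v|_{\partial K}\in C^0(\partial K),\ v|_f\in V^f\ \text{for all faces } f\text{ of }K,\ \Delta v\in\mathbb P_{k-2}(K)\}$ and $V_h=\{v\in H^1(\Omega_h): v|_K\in V^K\ \forall K\}$. **Norms and forms.** $$|u|_{1,h}^2=\sum_K|u|_{1,K}^2,\quad \|\mu\|_{-1/2,h}^2=\sum_{f\in\mathcal F^\partial}\tilde h_f\|\mu\|_{0,f}^2,\quad \|u\|_{1,h}^2=|u|_{1,h}^2+\sum_{f\in\mathcal F^\partial}\tilde h_f^{-1}\|\Pi^0_\partial u\|_{0,f}^2.$$ Let $S^K$ be symmetric bilinear forms on $V^K$ with $c_*|\phi|_{1,K}^2\le S^K(\phi,\phi)\le C^*|\phi|^2_{1,K}$ for all $\phi\in V^K$ with $\Pi^\nabla_K\phi=0$, where $c_*,C^*>0$ do not depend on $K$, and put $a_h(u,v)=\sum_K\big(\int_K\nabla\Pi^\nabla u\cdot\nabla\Pi^\nabla v+S^K(u-\Pi^\nabla u,v-\Pi^\nabla v)\big)$, $$\mathfrak a_h(u,\lambda;v,\mu)=a_h(u,v)+\int_{\Gamma_h}\lambda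 v+\int_{\Gamma_h}\mu u-\alpha\sum_{f\in\mathcal F^\partial}\tilde h_f\int_f(\lambda+\partial_\nu\Pi^\nabla u)(\mu+\partial_\nu\Pi^\nabla v),$$ $$\mathscr C(u,\mu)=\sum_{f\in\mathcal F^\partial}\sum_{j=1}^{k^*}\int_f\frac{\delta^j}{j!}\,\partial_\sigma^j(\Pi^\nabla u)\,\mu .$$ **Lemma.** There exist $C>0$ and $\alpha_0\in(0,1]$, depending only on $d,k,\gamma_0,N_0$, such that the following holds. 1. In the above setting, for all $u_h\in V_h$ and $\mu_h\in\Lambda_h$, $$\mathscr C(u_h,\mu_h)\le C\,\tau\,|u_h|_{1,h}\,\|\mu_h\|_{-1/2,h}.$$ 2. For every $0<\alpha<\alpha_0$ the number $\tau_\alpha=(\sqrt\alpha-\alpha)/C$ is positive and, for every $\tau\in(0,1)$ with $\tau<\tau_\alpha$ and all $c_*,C^*>0$, there is a constant $c>0$, depending only on $d,k,\gamma_0,N_0,\alpha,\tau,c_*,C^*$, such that whenever (1) holds with this $\tau$, for all $(u_h,\lambda_h)\in V_h\times\Lambda_h$, $$\sup_{(v_h,\mu_h)}\frac{\mathfrak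 a_h(u_h,\lambda_h;v_h,\mu_h)+\mathscr C(u_h,\mu_h)}{\|v_h\|_{1,h}+\|\mu_h\|_{-1/2,h}}\ \ge\ c\,\big(\|u_h\|_{1,h}+\|\lambda_h\|_{-1/2,h}\big),$$ the supremum being over all $(v_h,\mu_h)\in V_h\times\Lambda_h$ with $\|v_h\|_{1,h}+\|\mu_h\|_{-1/2,h}>0$. -/

import Mathlib

open MeasureTheory Filter Topology

noncomputable section

namespace VEM

/-- Euclidean space `ℝ^N`. -/
abbrev E (N : ℕ) : Type := EuclideanSpace ℝ (Fin N)

/-! ### Polynomials -/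

/-- Polynomials in `N` variables of degree at most `m`; for `m = -1` this is `{0}`. -/
def polyDeg (N : ℕ) (m : ℤ) : Submodule ℝ (MvPolynomial (Fin N) ℝ) :=
  MvPolynomial.restrictSupport ℝ {s : Fin N →₀ ℕ | ((Finsupp.degree s : ℕ) : ℤ) ≤ m}

/-- The polynomial function on `ℝ^N` attached to a polynomial. -/
def polyFun {N : ℕ} (p : MvPolynomial (Fin N) ℝ) (x : E N) : ℝ :=
  MvPolynomial.eval (fun i => x i) p

/-- The `j`-th derivative of `p` at `x` in the direction `s`. -/
def dirDeriv {N : ℕ} (j : ℕ) (s : E N) (p : MvPolynomial (Fin N) ℝ) (x : E N) : ℝ :=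
  iteratedDeriv j (fun t : ℝ => polyFun p (x + t • s)) 0

/-! ### First order Sobolev spaces -/

/-- Test functions on the open set `U`: smooth functions with compact support inside `U`. -/
def IsTest {N : ℕ} (U : Set (E N)) (φ : E N → ℝ) : Prop :=
  ContDiff ℝ (⊤ : ℕ∞) φ ∧ HasCompactSupport φ ∧ tsupport φ ⊆ U

/-- `g` is the distributional gradient of `v` on `U`, and it is square integrable. -/
def IsWeakGrad {N : ℕ} (U : Set (E N)) (v : E N → ℝ) (g : E N → E N) : Prop :=
  MemLp g 2 (volume.restrict U) ∧
    ∀ φ, IsTest U φ → ∫ x in U, v x • gradient φ x = - ∫ x in U, φ x • g x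

/-- Membership in `H¹(U)`. -/
def InH1 {N : ℕ} (U : Set (E N)) (v : E N → ℝ) : Prop :=
  MemLp v 2 (volume.restrict U) ∧ ∃ g, IsWeakGrad U v g

open Classical in
/-- The weak gradient of `v ∈ H¹(U)` (unique almost everywhere on the open set `U`). -/
def weakGrad {N : ℕ} (U : Set (E N)) (v : E N → ℝ) : E N → E N :=
  if h : ∃ g, IsWeakGrad U v g then h.choose else 0

/-- `Δ v ∈ ℙ_m(U)` in the sense of distributions, for `v ∈ H¹(U)`. -/
def HasPolyLaplacian {N : ℕ} (U : Set (E N)) (m : ℤ) (v : E N → ℝ) : Prop :=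
  ∃ p ∈ polyDeg N m, ∀ φ, IsTest U φ →
    ∫ x in U, inner ℝ (weakGrad U v x) (gradient φ x) = - ∫ x in U, polyFun p x * φ x

/-! ### Polygonal and polyhedral tessellations -/

/-- The data of a tessellation of a polygonal (`n = 1`) or polyhedral (`n = 2`) domain of
`ℝ^(n+1)`: finitely many elements; finitely many `n`-dimensional faces, each one being the image
of a subset of `ℝ^n` under an affine isometry; finitely many edges, given by their end points
(used only if `n = 2`; if `n = 1` the "faces" are the sides of the polygons); for each face an
element containing it in its boundary; and a vector attached to each face, which on boundary faces
is the outer unit normal. -/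
structure Mesh (n : ℕ) where
  numElt : ℕ
  numFace : ℕ
  numEdge : ℕ
  elt : Fin numElt → Set (E (n + 1))
  faceDom : Fin numFace → Set (E n)
  faceParam : Fin numFace → (E n →ᵃⁱ[ℝ] E (n + 1))
  edgeFst : Fin numEdge → E (n + 1)
  edgeSnd : Fin numEdge → E (n + 1)
  adj : Fin numFace → Fin numElt
  normal : Fin numFace → E (n + 1)

namespace Mesh

variable {n : ℕ} (M : Mesh n)

/-- The relative interior of a face. -/
def openFace (f : Fin M.numFace) : Set (E (n + 1)) := M.faceParam f '' M.faceDom f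

/-- The closed face. -/
def closedFace (f : Fin M.numFace) : Set (E (n + 1)) := M.faceParam f '' closure (M.faceDom f)

/-- The relative boundary of a face. -/
def relBoundary (f : Fin M.numFace) : Set (E (n + 1)) := M.faceParam f '' frontier (M.faceDom f)

/-- The closed edge. -/
def edge (e : Fin M.numEdge) : Set (E (n + 1)) := segment ℝ (M.edgeFst e) (M.edgeSnd e)

/-- The tessellated domain `Ω_h`. -/
def domain : Set (E (n + 1)) := interior (⋃ K, closure (M.elt K))

open Classical in
/-- The faces lying on the boundary of the element `K`. -/
def facesOf (K : Fin M.numElt) : Finset (Fin M.numFace) :=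
  Finset.univ.filter fun f => M.closedFace f ⊆ frontier (M.elt K)

open Classical in
/-- The faces lying on the boundary `Γ_h` of the domain `Ω_h`. -/
def bdFaces : Finset (Fin M.numFace) :=
  Finset.univ.filter fun f => M.closedFace f ⊆ frontier M.domain

open Classical in
/-- The edges lying on the relative boundary of the face `f`. -/
def edgesOf (f : Fin M.numFace) : Finset (Fin M.numEdge) :=
  Finset.univ.filter fun e => M.edge e ⊆ M.relBoundary f

/-- `M` is a tessellation of the polygonal / polyhedral domain `M.domain`. -/
structure IsTessellation : Prop where
  numElt_pos : 0 < M.numElt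
  elt_open : ∀ K, IsOpen (M.elt K)
  elt_nonempty : ∀ K, (M.elt K).Nonempty
  elt_bounded : ∀ K, Bornology.IsBounded (M.elt K)
  elt_disjoint : ∀ K K', K ≠ K' → Disjoint (M.elt K) (M.elt K')
  face_open : ∀ f, IsOpen (M.faceDom f)
  face_nonempty : ∀ f, (M.faceDom f).Nonempty
  face_interval : n = 1 → ∀ f, Convex ℝ (M.faceDom f)
  face_disjoint : ∀ f f', f ≠ f' → Disjoint (M.openFace f) (M.openFace f')
  adj_mem : ∀ f, f ∈ M.facesOf (M.adj f)
  adj_unique : ∀ f ∈ M.bdFaces, ∀ K, f ∈ M.facesOf K → K = M.adj f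
  elt_frontier : ∀ K, frontier (M.elt K) = ⋃ f ∈ M.facesOf K, M.closedFace f
  domain_frontier : frontier M.domain = ⋃ f ∈ M.bdFaces, M.closedFace f
  edge_ne : ∀ e, M.edgeFst e ≠ M.edgeSnd e
  edge_disjoint : ∀ e e', e ≠ e' →
    Disjoint (openSegment ℝ (M.edgeFst e) (M.edgeSnd e))
      (openSegment ℝ (M.edgeFst e') (M.edgeSnd e'))
  face_frontier : n = 2 → ∀ f, M.relBoundary f = ⋃ e ∈ M.edgesOf f, M.edge e
  normal_norm : ∀ f ∈ M.bdFaces, ‖M.normal f‖ = 1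
  normal_orthogonal : ∀ f ∈ M.bdFaces, ∀ y,
    inner ℝ (M.normal f) ((M.faceParam f).linearIsometry y) = 0
  normal_outer : ∀ f ∈ M.bdFaces, ∀ x ∈ M.openFace f, ∀ᶠ t : ℝ in 𝓝[>] 0,
    x + t • M.normal f ∉ M.domain ∧ x - t • M.normal f ∈ M.domain

/-- Shape regularity with parameters `γ₀` and `N₀`. -/
structure ShapeRegular (γ₀ : ℝ) (N₀ : ℕ) : Prop where
  elt_star : ∀ K, ∃ c ρ, γ₀ * Metric.diam (M.elt K) ≤ ρ ∧
    ∀ y ∈ Metric.ball c ρ, StarConvex ℝ y (M.elt K)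
  card_faces : ∀ K, (M.facesOf K).card ≤ N₀
  face_star : n = 2 → ∀ f, ∃ c ρ, γ₀ * Metric.diam (M.faceDom f) ≤ ρ ∧
    ∀ y ∈ Metric.ball c ρ, StarConvex ℝ y (M.faceDom f)
  card_edges : n = 2 → ∀ f, (M.edgesOf f).card ≤ N₀

/-- The diameter `h_K` of the element `K`. -/
def hElt (K : Fin M.numElt) : ℝ := Metric.diam (M.elt K)

/-- The diameter of the element containing the boundary face `f`. -/
def hFace (f : Fin M.numFace) : ℝ := M.hElt (M.adj f)

/-- The surface integral of `w` over the face `f`. -/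
def intFace (f : Fin M.numFace) (w : E (n + 1) → ℝ) : ℝ :=
  ∫ y in M.faceDom f, w (M.faceParam f y)

/-- The arc length integral of `w` over the edge `e`. -/
def intEdge (e : Fin M.numEdge) (w : E (n + 1) → ℝ) : ℝ :=
  dist (M.edgeFst e) (M.edgeSnd e) *
    ∫ t in (0 : ℝ)..1, w (AffineMap.lineMap (M.edgeFst e) (M.edgeSnd e) t)

/-! ### Projections onto polynomials -/

/-- `p` is the elliptic projection `Π^{∇,k}_K v` of `v ∈ H¹(K)`. -/
def IsEllProj (k : ℕ) (K : Fin M.numElt) (v : E (n + 1) → ℝ)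
    (p : MvPolynomial (Fin (n + 1)) ℝ) : Prop :=
  p ∈ polyDeg (n + 1) k ∧
  (∀ w ∈ polyDeg (n + 1) k,
    ∫ x in M.elt K, inner ℝ (gradient (polyFun p) x) (gradient (polyFun w) x) =
      ∫ x in M.elt K, inner ℝ (weakGrad (M.elt K) v x) (gradient (polyFun w) x)) ∧
  ∑ f ∈ M.facesOf K, M.intFace f (polyFun p) = ∑ f ∈ M.facesOf K, M.intFace f v

open Classical in
/-- The elliptic projection `Π^{∇,k}_K v`. -/
def ellProj (k : ℕ) (K : Fin M.numElt) (v : E (n + 1) → ℝ) : MvPolynomial (Fin (n + 1)) ℝ :=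
  if h : ∃ p, M.IsEllProj k K v p then h.choose else 0

/-- The restriction of `p` to the face `f` is the elliptic projection `Π^{∇,k}_f v` of
`v ∈ H¹(f)`; the mean value condition is imposed on the edges of `f`. -/
def IsFaceEllProj (k : ℕ) (f : Fin M.numFace) (v : E (n + 1) → ℝ)
    (p : MvPolynomial (Fin (n + 1)) ℝ) : Prop :=
  p ∈ polyDeg (n + 1) k ∧
  (∀ w ∈ polyDeg n k,
    ∫ y in M.faceDom f, inner ℝ (gradient (fun z => polyFun p (M.faceParam f z)) y)
        (gradient (polyFun w) y) =
      ∫ y in M.faceDom f, inner ℝ (weakGrad (M.faceDom f) (fun z => v (M.faceParam f z)) y)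
        (gradient (polyFun w) y)) ∧
  ∑ e ∈ M.edgesOf f, M.intEdge e (polyFun p) = ∑ e ∈ M.edgesOf f, M.intEdge e v

/-- In the coordinates of the face `f`, the polynomial `p` is the `L²(f)` projection
`Π^{0,m}_f v` of `v`. -/
def IsFaceProj (m : ℕ) (f : Fin M.numFace) (v : E (n + 1) → ℝ)
    (p : MvPolynomial (Fin n) ℝ) : Prop :=
  p ∈ polyDeg n m ∧ ∀ q ∈ polyDeg n m,
    ∫ y in M.faceDom f, polyFun p y * polyFun q y =
      ∫ y in M.faceDom f, v (M.faceParam f y) * polyFun q y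

open Classical in
/-- The `L²(f)` projection `Π^{0,m}_f v`, in the coordinates of the face `f`. -/
def faceProj (m : ℕ) (f : Fin M.numFace) (v : E (n + 1) → ℝ) : MvPolynomial (Fin n) ℝ :=
  if h : ∃ p, M.IsFaceProj m f v p then h.choose else 0

end Mesh

/-! ### The virtual element space -/

/-- A basis `low` of `ℙ_{k-2}(ℝ^n)` contained in a basis `high` of `ℙ_k(ℝ^n)`. -/
structure NestedBases (n k : ℕ) where
  low : Set (MvPolynomial (Fin n) ℝ)
  high : Set (MvPolynomial (Fin n) ℝ)
  low_subset : low ⊆ high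
  linearIndependent : LinearIndepOn ℝ id high
  span_low : Submodule.span ℝ low = polyDeg n ((k : ℤ) - 2)
  span_high : Submodule.span ℝ high = polyDeg n k

namespace Mesh

variable {n : ℕ} (M : Mesh n)

/-- The local virtual space on a face `f`. In the polygonal case (`n = 1`) it consists of the
polynomials of degree `≤ k` on the side `f`. In the polyhedral case (`n = 2`) it consists of the
`v ∈ C⁰(f)` that are polynomials of degree `≤ k` on each edge of `f`, with `Δ v ∈ ℙ_k(f)` and
`∫_f q v = ∫_f q Π^{∇,k}_f v` for all `q` in the difference of the two given bases. -/
def InFaceSpace (k : ℕ) (B : Fin M.numFace → NestedBases n k) (f : Fin M.numFace)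
    (v : E (n + 1) → ℝ) : Prop :=
  (n = 1 → ∃ p ∈ polyDeg (n + 1) k, ∀ x ∈ M.closedFace f, v x = polyFun p x) ∧
  (n = 2 →
    ContinuousOn v (M.closedFace f) ∧
    (∀ e ∈ M.edgesOf f, ∃ p ∈ polyDeg (n + 1) k, ∀ x ∈ M.edge e, v x = polyFun p x) ∧
    InH1 (M.faceDom f) (fun y => v (M.faceParam f y)) ∧
    HasPolyLaplacian (M.faceDom f) k (fun y => v (M.faceParam f y)) ∧
    ∃ p, M.IsFaceEllProj k f v p ∧ ∀ q ∈ (B f).high \ (B f).low,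
      ∫ y in M.faceDom f, polyFun q y * v (M.faceParam f y) =
        ∫ y in M.faceDom f, polyFun q y * polyFun p (M.faceParam f y))

/-- The values of `v` on `∂K` are the trace of `v|_K ∈ H¹(K)`: there are smooth functions which
converge to `v` in `H¹(K)` and whose restrictions converge to `v` in `L²(∂K)`. -/
def HasOwnTrace (K : Fin M.numElt) (v : E (n + 1) → ℝ) : Prop :=
  ∃ φ : ℕ → E (n + 1) → ℝ,
    (∀ m, ContDiff ℝ (⊤ : ℕ∞) (φ m)) ∧
    Tendsto (fun m => eLpNorm (fun x => φ m x - v x) 2 (volume.restrict (M.elt K))) atTop (𝓝 0) ∧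
    Tendsto (fun m => eLpNorm (fun x => gradient (φ m) x - weakGrad (M.elt K) v x) 2
      (volume.restrict (M.elt K))) atTop (𝓝 0) ∧
    ∀ f ∈ M.facesOf K, Tendsto (fun m =>
      eLpNorm (fun y => φ m (M.faceParam f y) - v (M.faceParam f y)) 2
        (volume.restrict (M.faceDom f))) atTop (𝓝 0)

/-- The local virtual element space `V_k^K`. An element of `H¹(K)` is represented by a function
whose values on `∂K` are its trace. -/
def InEltSpace (k : ℕ) (B : Fin M.numFace → NestedBases n k) (K : Fin M.numElt)
    (v : E (n + 1) → ℝ) : Prop :=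
  InH1 (M.elt K) v ∧ M.HasOwnTrace K v ∧
  ContinuousOn v (frontier (M.elt K)) ∧ (∀ f ∈ M.facesOf K, M.InFaceSpace k B f v) ∧
  HasPolyLaplacian (M.elt K) ((k : ℤ) - 2) v

/-- The virtual element space `V_h`. -/
def spaceV (k : ℕ) (B : Fin M.numFace → NestedBases n k) : Set (E (n + 1) → ℝ) :=
  {v | InH1 M.domain v ∧ ∀ K, M.InEltSpace k B K v}

/-- The multiplier space `Λ_h` of piecewise polynomials of degree `≤ k'` on `Γ_h`. -/
def spaceΛ (k' : ℕ) : Set (E (n + 1) → ℝ) :=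
  {μ | ∀ f ∈ M.bdFaces, ∃ p ∈ polyDeg n k', ∀ y ∈ M.faceDom f, μ (M.faceParam f y) = polyFun p y}

/-! ### Norms -/

/-- The square of the seminorm `|v|_{1,K}`. -/
def semiSq (K : Fin M.numElt) (v : E (n + 1) → ℝ) : ℝ :=
  ∫ x in M.elt K, ‖weakGrad (M.elt K) v x‖ ^ 2

/-- The broken seminorm `|v|_{1,h}`. -/
def seminormOne (v : E (n + 1) → ℝ) : ℝ := √(∑ K, M.semiSq K v)

/-- The norm `‖v‖_{1,h}`, with `‖v‖²_{1,h} = |v|²_{1,h} + ∑_f h_{K(f)}⁻¹ ‖Π^{0,k'}_f v‖²_{0,f}`. -/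
def normOne (k' : ℕ) (v : E (n + 1) → ℝ) : ℝ :=
  √(M.seminormOne v ^ 2 + ∑ f ∈ M.bdFaces,
    (M.hFace f)⁻¹ * ∫ y in M.faceDom f, polyFun (M.faceProj k' f v) y ^ 2)

/-- The norm `‖μ‖_{-1/2,h}`. -/
def normNegHalf (μ : E (n + 1) → ℝ) : ℝ :=
  √(∑ f ∈ M.bdFaces, M.hFace f * M.intFace f fun x => μ x ^ 2)

/-! ### Bilinear forms -/

/-- `S` is an admissible family of stabilizing bilinear forms with constants `cLow`, `cUp`.
Each `S K` matters only on `V_k^K` (every bilinear form on a subspace is the restriction of a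
bilinear form on the whole space). -/
structure IsStabilization (k : ℕ) (B : Fin M.numFace → NestedBases n k) (cLow cUp : ℝ)
    (S : Fin M.numElt → LinearMap.BilinForm ℝ (E (n + 1) → ℝ)) : Prop where
  symm : ∀ K v w, M.InEltSpace k B K v → M.InEltSpace k B K w → S K v w = S K w v
  bounds : ∀ K v, M.InEltSpace k B K v → M.IsEllProj k K v 0 →
    cLow * M.semiSq K v ≤ S K v v ∧ S K v v ≤ cUp * M.semiSq K v

/-- The discrete bilinear form `a_h`. -/
def formA (k : ℕ) (S : Fin M.numElt → LinearMap.BilinForm ℝ (E (n + 1) → ℝ))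
    (u v : E (n + 1) → ℝ) : ℝ :=
  ∑ K, ((∫ x in M.elt K, inner ℝ (gradient (polyFun (M.ellProj k K u)) x)
      (gradient (polyFun (M.ellProj k K v)) x)) +
    S K (u - polyFun (M.ellProj k K u)) (v - polyFun (M.ellProj k K v)))

/-- The function `∂_ν Π^∇(u)` on the boundary face `f`. -/
def normalDeriv (k : ℕ) (f : Fin M.numFace) (u : E (n + 1) → ℝ) (x : E (n + 1)) : ℝ :=
  inner ℝ (gradient (polyFun (M.ellProj k (M.adj f) u)) x) (M.normal f)

/-- The stabilized bilinear form `𝔞_h^{BH}(u, lam; v, μ)`. -/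
def formBH (k : ℕ) (S : Fin M.numElt → LinearMap.BilinForm ℝ (E (n + 1) → ℝ)) (α : ℝ)
    (u lam v μ : E (n + 1) → ℝ) : ℝ :=
  M.formA k S u v + ∑ f ∈ M.bdFaces, M.intFace f (fun x => lam x * v x) +
    ∑ f ∈ M.bdFaces, M.intFace f (fun x => μ x * u x) -
    α * ∑ f ∈ M.bdFaces, M.hFace f * M.intFace f fun x =>
      (lam x + M.normalDeriv k f u x) * (μ x + M.normalDeriv k f v x)

/-! ### The curved domain and the boundary correction -/

end Mesh

/-- The distance `δ(x)` from `x` to `∂Ω` along the direction `s`: the smallest `t ≥ 0` such that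
`x + t s ∈ ∂Ω`. -/
def delta {N : ℕ} (Ω : Set (E N)) (s x : E N) : ℝ :=
  sInf {t : ℝ | 0 ≤ t ∧ x + t • s ∈ frontier Ω}

namespace Mesh

variable {n : ℕ} (M : Mesh n)

/-- The tessellated domain `Ω_h` is contained in the bounded domain `Ω`; `σ` is a unit outward
direction on each boundary face; and the distance along `σ` from a point of a boundary face to
`∂Ω` is at most `τ` times the diameter of the element containing the face. -/
structure IsApproximation (Ω : Set (E (n + 1))) (σ : Fin M.numFace → E (n + 1)) (τ : ℝ) :
    Prop where
  isOpen : IsOpen Ω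
  isBounded : Bornology.IsBounded Ω
  subset : M.domain ⊆ Ω
  norm_dir : ∀ f ∈ M.bdFaces, ‖σ f‖ = 1
  outward : ∀ f ∈ M.bdFaces, 0 < inner ℝ (σ f) (M.normal f)
  delta_le : ∀ f ∈ M.bdFaces, ∀ x ∈ M.closedFace f, delta Ω (σ f) x ≤ τ * M.hFace f

/-- The boundary correction term `𝒞(u, μ)` with Taylor expansion of order `kStar`. -/
def formC (k kStar : ℕ) (Ω : Set (E (n + 1))) (σ : Fin M.numFace → E (n + 1))
    (u μ : E (n + 1) → ℝ) : ℝ :=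
  ∑ f ∈ M.bdFaces, ∑ j ∈ Finset.Icc 1 kStar, M.intFace f fun x =>
    delta Ω (σ f) x ^ j / (j.factorial : ℝ) *
      dirDeriv j (σ f) (M.ellProj k (M.adj f) u) x * μ x

end Mesh

end VEM

end

/-! Boundedness of the correction. On a face, `δ ≤ τ h` and `j ≥ 1` give `δ ^ j ≤ τ h ^ j`, so it
suffices to control `h ^ j ∂_σ^j p` for polynomials `p`. This is an inverse estimate. On a reference
ball the gradient seminorm of a polynomial vanishes only on constants, which every derivative of
order at least one kills; finite dimensionality gives a bound (`exists_dirDeriv_le_gradL2`), and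
scaling together with the ball inside each star shaped element transfers it to the mesh
(`exists_inverse_estimate`, `exists_face_inverse_estimate`). Each element owns at most `N₀` boundary
faces, so summation gives `exists_abs_formC_le`, with the seminorm of `Π^∇ u` on the right.

Stability. Write `X`, `Z`, `W`, `Y` for the squares of the broken seminorm of `Π^∇ u`, of that of `u
- Π^∇ u`, of the boundary part of `‖u‖_{1,h}`, and of `‖λ‖_{-1/2,h}`. The test pair is `v = u`, `μ =
-λ + ε h⁻¹ Π⁰ u` with `ε = 1/16`. Then `a_h(u, u) ≥ X + c_* Z`. In the two boundary pairings `λ`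
cancels and `ε W` remains. Up to terms of order `ε`, the stabilization is `-α ∑ h ∫ ((∂_ν Π^∇ u)² -
λ²)`: it yields `α Y` and costs `α ∑ h ∫ (∂_ν Π^∇ u)²`, which the inverse estimate
(`exists_normalDeriv_le`) absorbs into `X` once `α` is small. The correction costs at most `C τ √X
‖μ‖_{-1/2,h}` with `C τ ≤ √α`, and Young's inequality splits this between `X` and `α Y`. The
bookkeeping is `stability_arith`; since the test pair has norm at most a multiple of the norm of the
data, `exists_test_pair` follows. Data of norm zero need a separate test function
(`exists_nonneg_of_zero`). -/

noncomputable section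

namespace VEM

/-! ### Polynomial functions -/

section Poly

variable {N : ℕ}

@[simp] lemma polyFun_add (p q : MvPolynomial (Fin N) ℝ) (x : E N) :
    polyFun (p + q) x = polyFun p x + polyFun q x := by simp [polyFun]

@[simp] lemma polyFun_sub (p q : MvPolynomial (Fin N) ℝ) (x : E N) :
    polyFun (p - q) x = polyFun p x - polyFun q x := by simp [polyFun]

@[simp] lemma polyFun_neg (p : MvPolynomial (Fin N) ℝ) (x : E N) :
    polyFun (-p) x = - polyFun p x := by simp [polyFun]

@[simp] lemma polyFun_smul (c : ℝ) (p : MvPolynomial (Fin N) ℝ) (x : E N) :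
    polyFun (c • p) x = c * polyFun p x := by simp [polyFun]

@[simp] lemma polyFun_C (c : ℝ) (x : E N) : polyFun (MvPolynomial.C c) x = c := by simp [polyFun]

@[simp] lemma polyFun_zero (x : E N) : polyFun (0 : MvPolynomial (Fin N) ℝ) x = 0 := by
  simp [polyFun]

@[simp] lemma polyFun_sum {ι : Type*} (s : Finset ι) (p : ι → MvPolynomial (Fin N) ℝ) (x : E N) :
    polyFun (∑ i ∈ s, p i) x = ∑ i ∈ s, polyFun (p i) x := by simp [polyFun]

lemma analyticOnNhd_polyFun (p : MvPolynomial (Fin N) ℝ) :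
    AnalyticOnNhd ℝ (polyFun p) Set.univ := by
  have h := AnalyticOnNhd.aeval_mvPolynomial (𝕜 := ℝ) (s := (Set.univ : Set (E N)))
    (f := fun (x : E N) (i : Fin N) => x i)
    (fun i => (EuclideanSpace.proj (𝕜 := ℝ) i : E N →L[ℝ] ℝ).analyticOnNhd _) p
  simpa [polyFun, MvPolynomial.aeval_eq_eval] using! h

lemma contDiff_polyFun (p : MvPolynomial (Fin N) ℝ) {m : WithTop ℕ∞} :
    ContDiff ℝ m (polyFun p) :=
  contDiffOn_univ.1 ((analyticOnNhd_polyFun p).contDiffOn uniqueDiffOn_univ)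

lemma continuous_polyFun (p : MvPolynomial (Fin N) ℝ) : Continuous (polyFun p) :=
  (contDiff_polyFun p (m := 0)).continuous

lemma differentiable_polyFun (p : MvPolynomial (Fin N) ℝ) : Differentiable ℝ (polyFun p) :=
  (contDiff_polyFun p (m := 1)).differentiable (by simp)

lemma mem_polyDeg {m : ℤ} {p : MvPolynomial (Fin N) ℝ} :
    p ∈ polyDeg N m ↔ ∀ s ∈ p.support, ((Finsupp.degree s : ℕ) : ℤ) ≤ m := Iff.rfl

lemma mem_polyDeg_nat {k : ℕ} {p : MvPolynomial (Fin N) ℝ} :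
    p ∈ polyDeg N k ↔ p.totalDegree ≤ k := by
  rw [MvPolynomial.totalDegree, Finset.sup_le_iff, mem_polyDeg]
  exact forall₂_congr fun s _ => Nat.cast_le

instance (k : ℕ) : FiniteDimensional ℝ (polyDeg N k) := by
  have h : polyDeg N k = MvPolynomial.restrictTotalDegree (Fin N) ℝ k := by
    ext p; rw [mem_polyDeg_nat, MvPolynomial.mem_restrictTotalDegree]
  rw [h]; infer_instance

lemma polyDeg_mono {m m' : ℤ} (h : m ≤ m') : polyDeg N m ≤ polyDeg N m' :=
  fun _ hp _ hs => (hp hs : _ ≤ m).trans h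

lemma C_mem_polyDeg (c : ℝ) (k : ℕ) : MvPolynomial.C c ∈ polyDeg N k := by
  rw [mem_polyDeg_nat, MvPolynomial.totalDegree_C]; exact Nat.zero_le _

lemma pderiv_mem_polyDeg {m : ℤ} {p : MvPolynomial (Fin N) ℝ} (hp : p ∈ polyDeg N m) (i : Fin N) :
    MvPolynomial.pderiv i p ∈ polyDeg N (m - 1) := by
  rw [mem_polyDeg] at hp ⊢
  intro s hs
  rw [MvPolynomial.mem_support_iff, MvPolynomial.coeff_pderiv] at hs
  have h1 : s + Finsupp.single i 1 ∈ p.support := by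
    rw [MvPolynomial.mem_support_iff]
    intro h0
    simp [h0] at hs
  have := hp _ h1
  rw [map_add, Finsupp.degree_single] at this
  push_cast at this
  linarith

/-- The composition of a polynomial with an affine map is a polynomial of the same degree. -/
lemma exists_polyFun_comp_affine {L N : ℕ} (A : E L →ᵃ[ℝ] E N) {k : ℕ}
    {p : MvPolynomial (Fin N) ℝ} (hp : p ∈ polyDeg N k) :
    ∃ q ∈ polyDeg L k, ∀ y, polyFun q y = polyFun p (A y) := by
  -- The coordinates of `A` as polynomials of degree at most one; substituting them for the
  -- variables cannot raise the degree.
  let l : Fin N → MvPolynomial (Fin L) ℝ := fun i =>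
    MvPolynomial.C (A 0 i) + ∑ j, MvPolynomial.C (A.linear (EuclideanSpace.single j 1) i) *
      MvPolynomial.X j
  have hl : ∀ i, (l i).totalDegree ≤ 1 := by
    intro i
    refine (MvPolynomial.totalDegree_add _ _).trans (max_le (by simp) ?_)
    refine MvPolynomial.totalDegree_finsetSum_le fun j _ => ?_
    refine (MvPolynomial.totalDegree_mul _ _).trans ?_
    simp
  have hle : ∀ i y, polyFun (l i) y = A y i := by
    intro i y
    have h1 : A y = A.linear y + A 0 := by
      have := A.map_vadd 0 y
      simpa using this
    have h2 : A.linear y = ∑ j, y j • A.linear (EuclideanSpace.single j 1) := by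
      conv_lhs => rw [← (EuclideanSpace.basisFun (Fin L) ℝ).sum_repr y, map_sum]
      simp
    rw [h1, h2]
    simp only [l, polyFun_add, polyFun_C, polyFun_sum]
    simp [polyFun, mul_comm, add_comm]
  refine ⟨MvPolynomial.bind₁ l p, ?_, fun y => ?_⟩
  · rw [mem_polyDeg_nat] at hp ⊢
    rw [MvPolynomial.bind₁, MvPolynomial.aeval_def, MvPolynomial.eval₂_eq]
    refine MvPolynomial.totalDegree_finsetSum_le fun s hs => ?_
    refine (MvPolynomial.totalDegree_mul _ _).trans ?_
    have h0 : ((algebraMap ℝ (MvPolynomial (Fin L) ℝ)) (MvPolynomial.coeff s p)).totalDegree = 0 :=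
      MvPolynomial.totalDegree_C _
    rw [h0, zero_add]
    refine (MvPolynomial.totalDegree_finsetProd _ _).trans ?_
    refine (Finset.sum_le_sum fun i _ => (MvPolynomial.totalDegree_pow _ _).trans
      (Nat.mul_le_mul_left _ (hl i))).trans ?_
    simpa [Finsupp.sum] using (MvPolynomial.le_totalDegree hs).trans hp
  · simp only [polyFun]
    rw [MvPolynomial.eval, MvPolynomial.eval₂Hom_bind₁]
    congr 2
    ext i
    exact hle i y

/-! ### Gradients of polynomials -/

lemma inner_gradient {f : E N → ℝ} (x v : E N) : inner ℝ (gradient f x) v = fderiv ℝ f x v := by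
  simp [gradient]

lemma gradient_apply {f : E N → ℝ} (x : E N) (i : Fin N) :
    gradient f x i = fderiv ℝ f x (EuclideanSpace.single i 1) := by
  rw [← inner_gradient, EuclideanSpace.inner_single_right]; simp

lemma gradient_polyFun_apply (p : MvPolynomial (Fin N) ℝ) (x : E N) (i : Fin N) :
    gradient (polyFun p) x i = polyFun (MvPolynomial.pderiv i p) x := by
  rw [gradient_apply]
  induction p using MvPolynomial.induction_on with
  | C a =>
    have : polyFun (MvPolynomial.C a : MvPolynomial (Fin N) ℝ) = fun _ => a := by ext; simp
    simp [this]
  | add p q hp hq =>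
    have : polyFun (p + q) = polyFun p + polyFun q := by ext; simp
    rw [this, fderiv_add (differentiable_polyFun p x) (differentiable_polyFun q x)]
    simp [hp, hq]
  | mul_X p j hp =>
    have hX : polyFun (MvPolynomial.X j : MvPolynomial (Fin N) ℝ)
        = (EuclideanSpace.proj (𝕜 := ℝ) j : E N →L[ℝ] ℝ) := by ext; simp [polyFun]
    have : polyFun (p * MvPolynomial.X j) = polyFun p * polyFun (MvPolynomial.X j) := by
      ext; simp [polyFun]
    rw [this, fderiv_mul (differentiable_polyFun p x) (differentiable_polyFun _ x), hX]
    simp only [add_apply, smul_apply, hp,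
      ContinuousLinearMap.fderiv, MvPolynomial.pderiv_mul, polyFun_add]
    simp only [polyFun, map_mul, MvPolynomial.pderiv_X, smul_eq_mul]
    by_cases hij : i = j
    · subst hij; simp; ring
    · simp [Ne.symm hij]; ring

lemma gradient_polyFun_add (p q : MvPolynomial (Fin N) ℝ) (x : E N) :
    gradient (polyFun (p + q)) x = gradient (polyFun p) x + gradient (polyFun q) x := by
  ext i; simp [gradient_polyFun_apply]

lemma gradient_polyFun_sub (p q : MvPolynomial (Fin N) ℝ) (x : E N) :
    gradient (polyFun (p - q)) x = gradient (polyFun p) x - gradient (polyFun q) x := by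
  ext i; simp [gradient_polyFun_apply]

lemma gradient_polyFun_smul (c : ℝ) (p : MvPolynomial (Fin N) ℝ) (x : E N) :
    gradient (polyFun (c • p)) x = c • gradient (polyFun p) x := by
  ext i; simp [gradient_polyFun_apply]

lemma gradient_polyFun_zero (x : E N) :
    gradient (polyFun (0 : MvPolynomial (Fin N) ℝ)) x = 0 := by
  ext i; simp [gradient_polyFun_apply]

lemma gradient_polyFun_C (c : ℝ) (x : E N) :
    gradient (polyFun (MvPolynomial.C c)) x = 0 := by
  ext i; simp [gradient_polyFun_apply]

lemma continuous_gradient_of_contDiff {f : E N → ℝ} (hf : ContDiff ℝ 1 f) :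
    Continuous (gradient f) :=
  (InnerProductSpace.toDual ℝ (E N)).symm.continuous.comp (hf.continuous_fderiv (by simp))

lemma continuous_gradient_polyFun (p : MvPolynomial (Fin N) ℝ) :
    Continuous (gradient (polyFun p)) :=
  continuous_gradient_of_contDiff (contDiff_polyFun p)

/-! ### Square integrability -/

lemma _root_.Continuous.memLp_restrict {F : Type*} [NormedAddCommGroup F]
    {f : E N → F} (hf : Continuous f) {U : Set (E N)} (hU : Bornology.IsBounded U) (q : ENNReal) :
    MemLp f q (volume.restrict U) := by
  have hc : IsCompact (closure U) := hU.isCompact_closure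
  refine MemLp.mono_measure (Measure.restrict_mono subset_closure le_rfl) ?_
  have : IsFiniteMeasure (volume.restrict (closure U)) :=
    ⟨by simpa using hc.measure_lt_top⟩
  obtain ⟨C, hC⟩ := hc.exists_bound_of_continuousOn hf.continuousOn
  refine MemLp.of_bound ?_ C ?_
  · exact hf.aestronglyMeasurable
  · exact (ae_restrict_iff' isClosed_closure.measurableSet).2 (.of_forall fun x hx => hC x hx)

/-- The gradient of a polynomial as an element of `L²(U)`. -/
def gradL2 (U : Set (E N)) (hU : Bornology.IsBounded U) :
    MvPolynomial (Fin N) ℝ →ₗ[ℝ] Lp (E N) 2 (volume.restrict U) where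
  toFun p := ((continuous_gradient_polyFun p).memLp_restrict hU 2).toLp _
  map_add' p q := by
    rw [← MemLp.toLp_add]
    exact MemLp.toLp_congr _ _ (.of_forall fun x => gradient_polyFun_add p q x)
  map_smul' c p := by
    rw [RingHom.id_apply, ← MemLp.toLp_const_smul]
    exact MemLp.toLp_congr _ _ (.of_forall fun x => gradient_polyFun_smul c p x)

lemma inner_toLp {μ : Measure (E N)} {f g : E N → E N} (hf : MemLp f 2 μ) (hg : MemLp g 2 μ) :
    inner ℝ (hf.toLp f) (hg.toLp g) = ∫ x, inner ℝ (f x) (g x) ∂μ := by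
  rw [L2.inner_def]
  refine integral_congr_ae ?_
  filter_upwards [hf.coeFn_toLp, hg.coeFn_toLp] with x h1 h2
  rw [h1, h2]

lemma norm_gradL2_sq (U : Set (E N)) (hU : Bornology.IsBounded U) (p : MvPolynomial (Fin N) ℝ) :
    ‖gradL2 U hU p‖ ^ 2 = ∫ x in U, ‖gradient (polyFun p) x‖ ^ 2 := by
  rw [← real_inner_self_eq_norm_sq]
  refine (inner_toLp ((continuous_gradient_polyFun p).memLp_restrict hU 2)
    ((continuous_gradient_polyFun p).memLp_restrict hU 2)).trans ?_
  simp

/-- The gradient vanishes almost everywhere, hence by continuity everywhere on `U`, so the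
polynomial is constant on a ball. Analyticity extends this to the whole space, which is why `U` need
not be connected. -/
lemma polyFun_eq_const_of_gradL2_eq_zero {U : Set (E N)} (hU : Bornology.IsBounded U)
    (hUo : IsOpen U) (hne : U.Nonempty) {p : MvPolynomial (Fin N) ℝ} (hp : gradL2 U hU p = 0) :
    ∃ a : ℝ, ∀ x, polyFun p x = a := by
  obtain ⟨c, hc⟩ := hne
  obtain ⟨r, hr, hball⟩ := Metric.isOpen_iff.1 hUo c hc
  have h0 : ∀ᵐ x ∂(volume.restrict U), gradient (polyFun p) x = 0 :=
    (MemLp.toLp_eq_toLp_iff ((continuous_gradient_polyFun p).memLp_restrict hU 2)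
      (MemLp.zero' : MemLp (fun _ : E N => (0 : E N)) 2 _)).1 (hp.trans (MemLp.toLp_zero _).symm)
  have h1 : Set.EqOn (gradient (polyFun p)) (fun _ => 0) U :=
    Measure.eqOn_open_of_ae_eq h0 hUo (continuous_gradient_polyFun p).continuousOn
      continuousOn_const
  have h2 : ∀ x ∈ Metric.ball c r, fderiv ℝ (polyFun p) x = 0 := by
    intro x hx
    ext v
    rw [← inner_gradient, h1 (hball hx)]
    simp
  have h3 : ∀ x ∈ Metric.ball c r, polyFun p x = polyFun p c := by
    intro x hx
    exact (convex_ball c r).is_const_of_fderivWithin_eq_zero (𝕜 := ℝ)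
      (differentiable_polyFun p).differentiableOn
      (fun y hy => by rw [fderivWithin_of_isOpen Metric.isOpen_ball hy, h2 y hy]) hx
      (Metric.mem_ball_self hr)
  refine ⟨polyFun p c, fun x => ?_⟩
  have := (analyticOnNhd_polyFun p).eq_of_eventuallyEq
    (g := fun _ => polyFun p c) analyticOnNhd_const (z₀ := c)
    (Filter.eventually_of_mem (Metric.ball_mem_nhds c hr) h3)
  exact congrFun this x

/-! ### Directional derivatives -/

/-- Expressing the directional derivative through the full `j`-th derivative gives linearity in `p`
and a bound uniform over all unit directions. -/
lemma dirDeriv_eq (j : ℕ) (s : E N) (p : MvPolynomial (Fin N) ℝ) (x : E N) :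
    dirDeriv j s p x = iteratedFDeriv ℝ j (polyFun p) x (fun _ => s) := by
  have h := (ContinuousLinearMap.toSpanSingleton ℝ s).iteratedFDeriv_comp_right (i := j) (n := j)
    (f := fun z => polyFun p (x + z))
    ((contDiff_polyFun p).comp (contDiff_const.add contDiff_id)) 0 le_rfl
  have h2 : (fun t : ℝ => polyFun p (x + t • s)) =
    (fun z => polyFun p (x + z)) ∘ (ContinuousLinearMap.toSpanSingleton ℝ s) := by
    ext t; simp
  rw [dirDeriv, iteratedDeriv_eq_iteratedFDeriv, h2, h, iteratedFDeriv_comp_add_left]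
  simp

lemma abs_dirDeriv_le (j : ℕ) {s : E N} (hs : ‖s‖ = 1) (p : MvPolynomial (Fin N) ℝ) (x : E N) :
    |dirDeriv j s p x| ≤ ‖iteratedFDeriv ℝ j (polyFun p) x‖ := by
  rw [dirDeriv_eq]
  simpa [hs] using (iteratedFDeriv ℝ j (polyFun p) x).le_opNorm (fun _ => s)

lemma dirDeriv_add (j : ℕ) (s : E N) (p q : MvPolynomial (Fin N) ℝ) (x : E N) :
    dirDeriv j s (p + q) x = dirDeriv j s p x + dirDeriv j s q x := by
  have : polyFun (p + q) = polyFun p + polyFun q := by ext; simp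
  rw [dirDeriv_eq, dirDeriv_eq, dirDeriv_eq, this, iteratedFDeriv_add_apply
    (contDiff_polyFun p).contDiffAt (contDiff_polyFun q).contDiffAt]
  rfl

lemma dirDeriv_smul (j : ℕ) (s : E N) (c : ℝ) (p : MvPolynomial (Fin N) ℝ) (x : E N) :
    dirDeriv j s (c • p) x = c * dirDeriv j s p x := by
  have : polyFun (c • p) = c • polyFun p := by ext; simp
  rw [dirDeriv_eq, dirDeriv_eq, this, iteratedFDeriv_const_smul_apply
    (contDiff_polyFun p).contDiffAt]
  rfl

lemma dirDeriv_eq_zero_of_const {j : ℕ} (hj : 1 ≤ j) (s : E N) {p : MvPolynomial (Fin N) ℝ} {a : ℝ}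
    (hp : ∀ x, polyFun p x = a) (x : E N) : dirDeriv j s p x = 0 := by
  simp only [dirDeriv, hp]
  rw [iteratedDeriv_const, if_neg (by omega)]

lemma dirDeriv_one (s : E N) (p : MvPolynomial (Fin N) ℝ) (x : E N) :
    dirDeriv 1 s p x = inner ℝ (gradient (polyFun p) x) s := by
  rw [dirDeriv_eq, inner_gradient]; simp

/-- `dirDeriv j s` as a linear map. -/
def dirDerivₗ (j : ℕ) (s x : E N) : MvPolynomial (Fin N) ℝ →ₗ[ℝ] ℝ where
  toFun p := dirDeriv j s p x
  map_add' p q := dirDeriv_add j s p q x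
  map_smul' c p := dirDeriv_smul j s c p x

/-! ### Inverse estimates for polynomials -/

/-- Inverse estimate on the reference configuration. -/
lemma exists_dirDeriv_le_gradL2 (k : ℕ) {γ : ℝ} (hγ : 0 < γ) :
    ∃ C : ℝ, 0 ≤ C ∧ ∀ j ∈ Finset.Icc 1 k, ∀ s : E N, ‖s‖ = 1 → ∀ x, ‖x‖ ≤ 1 →
      ∀ p ∈ polyDeg N k, |dirDeriv j s p x| ≤
        C * ‖gradL2 (Metric.ball 0 γ) Metric.isBounded_ball p‖ := by
  let L := (gradL2 (Metric.ball (0 : E N) γ) Metric.isBounded_ball).domRestrict (polyDeg N k)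
  let R := LinearMap.range L
  -- The gradient map is not injective on `ℙ_k`, so a linear lift `σ` of its finite dimensional
  -- range `R` is fixed; all bounds are proved on a basis of `R`.
  obtain ⟨σ, hσ⟩ := L.rangeRestrict.exists_rightInverse_of_surjective L.range_rangeRestrict
  let b := Module.finBasis ℝ R
  have hcoord : ∀ i, ∃ c, 0 ≤ c ∧ ∀ y : R, |b.coord i y| ≤ c * ‖y‖ := by
    intro i
    let φ : R →L[ℝ] ℝ := LinearMap.toContinuousLinearMap (b.coord i)
    exact ⟨‖φ‖, norm_nonneg φ, fun y => φ.le_opNorm y⟩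
  choose c hc0 hc using hcoord
  have hbd : ∀ i, ∀ j : ℕ, ∃ D, 0 ≤ D ∧ ∀ s : E N, ‖s‖ = 1 → ∀ x, ‖x‖ ≤ 1 →
      |dirDeriv j s (σ (b i)).1 x| ≤ D := by
    intro i j
    obtain ⟨D, hD⟩ := (isCompact_closedBall (0 : E N) 1).exists_bound_of_continuousOn
      (f := iteratedFDeriv ℝ j (polyFun (σ (b i)).1))
      ((contDiff_polyFun _ (m := j)).continuous_iteratedFDeriv le_rfl).continuousOn
    refine ⟨max D 0, le_max_right _ _, fun s hs x hx => ?_⟩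
    exact (abs_dirDeriv_le j hs _ x).trans ((hD x (by simpa using hx)).trans (le_max_left _ _))
  choose D hD0 hD using hbd
  refine ⟨∑ j ∈ Finset.Icc 1 k, ∑ i, c i * D i j, Finset.sum_nonneg fun j _ =>
    Finset.sum_nonneg fun i _ => mul_nonneg (hc0 i) (hD0 i j), ?_⟩
  intro j hj s hs x hx p hp
  have hj1 : 1 ≤ j := (Finset.mem_Icc.1 hj).1
  set y : R := L.rangeRestrict ⟨p, hp⟩ with hy
  -- The polynomial and the lift of its gradient differ by a constant, invisible to derivatives of
  -- order `j ≥ 1`.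
  have hker : gradL2 (Metric.ball (0 : E N) γ) Metric.isBounded_ball (p - (σ y).1) = 0 := by
    have h1 : L.rangeRestrict (σ y) = y := LinearMap.congr_fun hσ y
    have h2 : L (σ y) = L ⟨p, hp⟩ := congrArg Subtype.val h1
    rw [map_sub, sub_eq_zero]
    exact h2.symm
  obtain ⟨a, ha⟩ := polyFun_eq_const_of_gradL2_eq_zero Metric.isBounded_ball Metric.isOpen_ball
    (Metric.nonempty_ball.2 hγ) hker
  have h3 : dirDeriv j s p x = dirDeriv j s (σ y).1 x := by
    have := dirDeriv_add j s (p - (σ y).1) (σ y).1 x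
    rwa [sub_add_cancel, dirDeriv_eq_zero_of_const hj1 s ha, zero_add] at this
  have h4 : dirDeriv j s (σ y).1 x = ∑ i, b.coord i y * dirDeriv j s (σ (b i)).1 x := by
    let T : R →ₗ[ℝ] ℝ := (dirDerivₗ j s x) ∘ₗ (polyDeg N k).subtype ∘ₗ σ
    change T y = _
    conv_lhs => rw [← b.sum_repr y, map_sum]
    simp only [map_smul]
    rfl
  have hyn : ‖y‖ = ‖gradL2 (Metric.ball (0 : E N) γ) Metric.isBounded_ball p‖ := rfl
  rw [h3, h4, ← hyn]
  have h5 : ∑ i, c i * D i j ≤ ∑ j ∈ Finset.Icc 1 k, ∑ i, c i * D i j :=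
    Finset.single_le_sum (f := fun j => ∑ i, c i * D i j)
      (fun j _ => Finset.sum_nonneg fun i _ => mul_nonneg (hc0 i) (hD0 i j)) hj
  refine le_trans ?_ (mul_le_mul_of_nonneg_right h5 (norm_nonneg _))
  rw [Finset.sum_mul]
  refine (Finset.abs_sum_le_sum_abs _ _).trans (Finset.sum_le_sum fun i _ => ?_)
  rw [abs_mul]
  calc |b.coord i y| * |dirDeriv j s (σ (b i)).1 x| ≤ (c i * ‖y‖) * D i j :=
        mul_le_mul (hc i y) (hD i j s hs x hx) (abs_nonneg _)
          (mul_nonneg (hc0 i) (norm_nonneg _))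
    _ = _ := by ring

lemma dirDeriv_of_scaled {p q : MvPolynomial (Fin N) ℝ} {c : E N} {h : ℝ}
    (hq : ∀ y, polyFun q y = polyFun p (c + h • y)) (j : ℕ) (s y : E N) :
    dirDeriv j s q y = h ^ j * dirDeriv j s p (c + h • y) := by
  have h1 : (fun t : ℝ => polyFun q (y + t • s)) =
      fun t => (fun r : ℝ => polyFun p (c + h • y + r • s)) (h * t) := by
    ext t
    simp only [hq]
    congr 1
    rw [smul_add, smul_smul, add_assoc]
  have h2 : ContDiff ℝ j (fun r : ℝ => polyFun p (c + h • y + r • s)) :=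
    (contDiff_polyFun p).comp (by fun_prop)
  rw [dirDeriv, h1, iteratedDeriv_comp_const_mul h2]
  simp [dirDeriv]

lemma gradient_of_scaled {p q : MvPolynomial (Fin N) ℝ} {c : E N} {h : ℝ}
    (hq : ∀ y, polyFun q y = polyFun p (c + h • y)) (y : E N) :
    gradient (polyFun q) y = h • gradient (polyFun p) (c + h • y) := by
  refine ext_inner_right ℝ fun s => ?_
  rw [← dirDeriv_one, dirDeriv_of_scaled hq, pow_one, dirDeriv_one, real_inner_smul_left]

/-- Inverse estimate on a set `U` of diameter comparable to `h` containing a ball of radius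
`γ h`. -/
lemma exists_inverse_estimate (k : ℕ) {γ : ℝ} (hγ : 0 < γ) :
    ∃ C : ℝ, 0 ≤ C ∧ ∀ (U : Set (E N)) (c : E N) (h : ℝ), 0 < h → Bornology.IsBounded U →
      Metric.ball c (γ * h) ⊆ U → ∀ j ∈ Finset.Icc 1 k, ∀ s : E N, ‖s‖ = 1 →
      ∀ x, dist x c ≤ h → ∀ p ∈ polyDeg N k,
      (h ^ j * dirDeriv j s p x) ^ 2 * h ^ N ≤
        C * h ^ 2 * ∫ z in U, ‖gradient (polyFun p) z‖ ^ 2 := by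
  obtain ⟨C, hC0, hC⟩ := exists_dirDeriv_le_gradL2 (N := N) k hγ
  refine ⟨C ^ 2, sq_nonneg _, fun U c h hh hU hball j hj s hs x hx p hp => ?_⟩
  let A : E N →ᵃ[ℝ] E N :=
    (AffineMap.const ℝ (E N) c) + (h • LinearMap.id : E N →ₗ[ℝ] E N).toAffineMap
  have hA : ∀ y, A y = c + h • y := fun y => by simp [A]
  obtain ⟨q, hq, hqp⟩ := exists_polyFun_comp_affine A hp
  simp only [hA] at hqp
  set y := h⁻¹ • (x - c) with hy
  have hxy : c + h • y = x := by rw [hy, smul_smul, mul_inv_cancel₀ hh.ne']; simp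
  have hyn : ‖y‖ ≤ 1 := by
    rw [hy, norm_smul, ← dist_eq_norm, Real.norm_of_nonneg (inv_nonneg.2 hh.le), inv_mul_le_iff₀ hh]
    simpa using hx
  have h1 := hC j hj s hs y hyn q hq
  have h2 := sq_le_sq' (by linarith [abs_nonneg (dirDeriv j s q y)]) h1
  rw [sq_abs, mul_pow, norm_gradL2_sq, dirDeriv_of_scaled hqp, hxy] at h2
  -- Change of variables `z = c + h y`: the chain rule contributes `h ^ 2` and the volume element `h
  -- ^ N`.
  have h3 : (∫ z in Metric.ball (0 : E N) γ, ‖gradient (polyFun q) z‖ ^ 2) * h ^ N =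
      h ^ 2 * ∫ z in Metric.ball c (γ * h), ‖gradient (polyFun p) z‖ ^ 2 := by
    have hpre : (fun y : E N => c + h • y) ⁻¹' (Metric.ball c (γ * h)) = Metric.ball 0 γ := by
      ext y
      simp only [Set.mem_preimage, Metric.mem_ball, dist_eq_norm, add_sub_cancel_left, norm_smul,
        Real.norm_of_nonneg hh.le, sub_zero, mul_comm γ h]
      exact mul_lt_mul_iff_right₀ hh
    have e1 : (∫ z in Metric.ball (0 : E N) γ, ‖gradient (polyFun q) z‖ ^ 2) =
        ∫ y : E N, (fun w => (Metric.ball c (γ * h)).indicator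
          (fun z => h ^ 2 * ‖gradient (polyFun p) z‖ ^ 2) (c + w)) (h • y) := by
      rw [← integral_indicator Metric.isOpen_ball.measurableSet]
      congr 1
      ext y
      rw [← hpre]
      simp only [Set.indicator, Set.mem_preimage, gradient_of_scaled hqp, norm_smul, mul_pow,
        Real.norm_eq_abs, sq_abs]
      rfl
    have e2 := Measure.integral_comp_smul (volume : Measure (E N))
      (fun w => (Metric.ball c (γ * h)).indicator
          (fun z => h ^ 2 * ‖gradient (polyFun p) z‖ ^ 2) (c + w)) h
    rw [e1, e2, integral_add_left_eq_self (μ := (volume : Measure (E N)))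
      (fun z => (Metric.ball c (γ * h)).indicator
          (fun z => h ^ 2 * ‖gradient (polyFun p) z‖ ^ 2) z) c,
      integral_indicator Metric.isOpen_ball.measurableSet, integral_const_mul]
    rw [finrank_euclideanSpace_fin, abs_of_pos (by positivity), smul_eq_mul]
    field_simp
  have h4 : ∫ z in Metric.ball c (γ * h), ‖gradient (polyFun p) z‖ ^ 2 ≤
      ∫ z in U, ‖gradient (polyFun p) z‖ ^ 2 := by
    refine setIntegral_mono_set ?_ (.of_forall fun _ => by positivity) (.of_forall hball)
    exact memLp_one_iff_integrable.1
      (((continuous_gradient_polyFun p).norm.pow 2).memLp_restrict hU 1)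
  calc _ ≤ _ := mul_le_mul_of_nonneg_right h2 (by positivity)
    _ = C ^ 2 * (h ^ 2 * ∫ z in Metric.ball c (γ * h), ‖gradient (polyFun p) z‖ ^ 2) := by
      rw [← h3]; ring
    _ ≤ _ := by rw [mul_assoc]; gcongr

end Poly

/-! ### Weak gradients -/

section WeakGrad

variable {N : ℕ} {U : Set (E N)}

lemma IsTest.gradient_eq_zero {φ : E N → ℝ} (hφ : IsTest U φ) {x : E N} (hx : x ∉ U) :
    gradient φ x = 0 := by
  have hx' : x ∉ tsupport φ := fun h => hx (hφ.2.2 h)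
  have h0 : φ =ᶠ[𝓝 x] fun _ => 0 := notMem_tsupport_iff_eventuallyEq.1 hx'
  rw [h0.gradient_eq]
  simp

lemma IsTest.eq_zero {φ : E N → ℝ} (hφ : IsTest U φ) {x : E N} (hx : x ∉ U) : φ x = 0 :=
  image_eq_zero_of_notMem_tsupport fun h => hx (hφ.2.2 h)

lemma IsTest.memLp {φ : E N → ℝ} (hφ : IsTest U φ) {μ : Measure (E N)}
    [IsFiniteMeasureOnCompacts μ] (q : ENNReal) : MemLp φ q μ :=
  hφ.1.continuous.memLp_of_hasCompactSupport hφ.2.1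

lemma IsTest.continuous_gradient {φ : E N → ℝ} (hφ : IsTest U φ) : Continuous (gradient φ) :=
  continuous_gradient_of_contDiff (hφ.1.of_le (by exact_mod_cast le_top))

lemma IsTest.hasCompactSupport_gradient {φ : E N → ℝ} (hφ : IsTest U φ) :
    HasCompactSupport (gradient φ) := by
  refine (hφ.2.1.fderiv (𝕜 := ℝ)).comp_left (g := (InnerProductSpace.toDual ℝ (E N)).symm) ?_
  simp

lemma IsTest.memLp_gradient {φ : E N → ℝ} (hφ : IsTest U φ) {μ : Measure (E N)}
    [IsFiniteMeasureOnCompacts μ] (q : ENNReal) : MemLp (gradient φ) q μ :=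
  hφ.continuous_gradient.memLp_of_hasCompactSupport hφ.hasCompactSupport_gradient

lemma integrable_smul_of_memLp {μ : Measure (E N)} {F : Type*} [NormedAddCommGroup F]
    [NormedSpace ℝ F] {f : E N → ℝ} {g : E N → F} (hf : MemLp f 2 μ) (hg : MemLp g 2 μ) :
    Integrable (fun x => f x • g x) μ :=
  memLp_one_iff_integrable.1 (hg.smul hf)

lemma integrable_inner_of_memLp {μ : Measure (E N)} {f g : E N → E N} (hf : MemLp f 2 μ)
    (hg : MemLp g 2 μ) : Integrable (fun x => inner ℝ (f x) (g x)) μ := by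
  refine (L2.integrable_inner (𝕜 := ℝ) (hf.toLp f) (hg.toLp g)).congr ?_
  filter_upwards [hf.coeFn_toLp, hg.coeFn_toLp] with x h1 h2
  rw [h1, h2]

/-- Integration by parts against a test function. -/
lemma integral_mul_fderiv_test {f φ : E N → ℝ} (hf : ContDiff ℝ 1 f) (hφ : IsTest U φ) (v : E N) :
    ∫ x in U, f x * fderiv ℝ φ x v = - ∫ x in U, fderiv ℝ f x v * φ x := by
  have hφ1 : ContDiff ℝ 1 φ := hφ.1.of_le (by exact_mod_cast le_top)
  have hz : ∀ x, x ∉ U → fderiv ℝ φ x v = 0 := fun x hx => by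
    rw [← inner_gradient, hφ.gradient_eq_zero hx, inner_zero_left]
  -- Everything vanishes outside `U`, so the integration by parts takes place on the whole space and
  -- has no boundary term.
  rw [setIntegral_eq_integral_of_forall_compl_eq_zero (fun x hx => by rw [hz x hx, mul_zero]),
    setIntegral_eq_integral_of_forall_compl_eq_zero (fun x hx => by rw [hφ.eq_zero hx, mul_zero])]
  have hcf := hf.continuous
  have hcf' : Continuous fun x => fderiv ℝ f x v :=
    (hf.continuous_fderiv (by simp)).clm_apply continuous_const
  have hcφ' : Continuous fun x => fderiv ℝ φ x v :=
    (hφ1.continuous_fderiv (by simp)).clm_apply continuous_const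
  have hsφ' : HasCompactSupport fun x => fderiv ℝ φ x v :=
    (hφ.2.1.fderiv (𝕜 := ℝ)).comp_left (g := fun L : E N →L[ℝ] ℝ => L v) (by simp)
  refine integral_mul_fderiv_eq_neg_fderiv_mul_of_integrable ?_ ?_ ?_ ?_ ?_
  · exact (hcf'.mul hφ.1.continuous).integrable_of_hasCompactSupport hφ.2.1.mul_left
  · exact (hcf.mul hcφ').integrable_of_hasCompactSupport hsφ'.mul_left
  · exact (hcf.mul hφ.1.continuous).integrable_of_hasCompactSupport hφ.2.1.mul_left
  · exact fun x _ => hf.differentiable (by simp) x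
  · exact fun x _ => hφ1.differentiable (by simp) x

lemma isWeakGrad_polyFun (hU : Bornology.IsBounded U) (p : MvPolynomial (Fin N) ℝ) :
    IsWeakGrad U (polyFun p) (gradient (polyFun p)) := by
  have hg := (continuous_gradient_polyFun p).memLp_restrict hU 2
  have hp := (continuous_polyFun p).memLp_restrict hU 2
  refine ⟨hg, fun φ hφ => ?_⟩
  refine ext_inner_left ℝ fun v => ?_
  rw [inner_neg_right, ← integral_inner (integrable_smul_of_memLp hp (hφ.memLp_gradient 2)),
    ← integral_inner (integrable_smul_of_memLp (hφ.memLp 2) hg)]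
  simp only [real_inner_comm _ v, real_inner_smul_left, inner_gradient]
  rw [integral_mul_fderiv_test (contDiff_polyFun p) hφ v]
  simp only [mul_comm]

lemma IsWeakGrad.sub {v w : E N → ℝ} {g g' : E N → E N} (hv : MemLp v 2 (volume.restrict U))
    (hw : MemLp w 2 (volume.restrict U)) (hg : IsWeakGrad U v g) (hg' : IsWeakGrad U w g') :
    IsWeakGrad U (v - w) (g - g') := by
  refine ⟨hg.1.sub hg'.1, fun φ hφ => ?_⟩
  simp only [Pi.sub_apply, sub_smul, smul_sub]
  rw [integral_sub (integrable_smul_of_memLp hv (hφ.memLp_gradient 2))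
      (integrable_smul_of_memLp hw (hφ.memLp_gradient 2)),
    integral_sub (integrable_smul_of_memLp (hφ.memLp 2) hg.1)
      (integrable_smul_of_memLp (hφ.memLp 2) hg'.1), hg.2 φ hφ, hg'.2 φ hφ]
  abel

/-- This is the fundamental lemma of the calculus of variations. It is what permits computing with
`weakGrad`, which is an arbitrary choice of a weak gradient. -/
lemma IsWeakGrad.ae_eq (hU : IsOpen U) {v : E N → ℝ} {g g' : E N → E N} (hg : IsWeakGrad U v g)
    (hg' : IsWeakGrad U v g') : g =ᵐ[volume.restrict U] g' := by
  have hloc : LocallyIntegrableOn (g - g') U := by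
    have h := (hg.1.sub hg'.1).locallyIntegrable (by norm_num)
    intro x hx
    obtain ⟨t, ht, hti⟩ := h x
    refine ⟨t ∩ U, inter_mem (mem_nhdsWithin_of_mem_nhds ht) self_mem_nhdsWithin, ?_⟩
    rw [IntegrableOn, Measure.restrict_restrict' hU.measurableSet] at hti
    exact hti
  have h := hU.ae_eq_zero_of_integral_contDiff_smul_eq_zero (μ := volume) hloc
    (fun φ h1 h2 h3 => by
      have hφ : IsTest U φ := ⟨h1, h2, h3⟩
      rw [← setIntegral_eq_integral_of_forall_compl_eq_zero (s := U)
        (fun x hx => by rw [hφ.eq_zero hx, zero_smul])]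
      simp only [Pi.sub_apply, smul_sub]
      rw [integral_sub (integrable_smul_of_memLp (hφ.memLp 2) hg.1)
        (integrable_smul_of_memLp (hφ.memLp 2) hg'.1), sub_eq_zero]
      have := (hg.2 φ hφ).symm.trans (hg'.2 φ hφ)
      exact neg_injective this)
  refine (ae_restrict_iff' hU.measurableSet).2 (h.mono fun x hx hxU => ?_)
  simpa [sub_eq_zero] using hx hxU

lemma InH1.isWeakGrad {v : E N → ℝ} (hv : InH1 U v) : IsWeakGrad U v (weakGrad U v) := by
  rw [weakGrad, dif_pos hv.2]
  exact hv.2.choose_spec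

lemma inH1_polyFun (hU : Bornology.IsBounded U) (p : MvPolynomial (Fin N) ℝ) :
    InH1 U (polyFun p) :=
  ⟨(continuous_polyFun p).memLp_restrict hU 2, _, isWeakGrad_polyFun hU p⟩

lemma InH1.sub {v w : E N → ℝ} (hv : InH1 U v) (hw : InH1 U w) : InH1 U (v - w) :=
  ⟨hv.1.sub hw.1, _, hv.isWeakGrad.sub hv.1 hw.1 hw.isWeakGrad⟩

lemma weakGrad_sub_polyFun (hUo : IsOpen U) (hU : Bornology.IsBounded U) {v : E N → ℝ}
    (hv : InH1 U v) (p : MvPolynomial (Fin N) ℝ) :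
    weakGrad U (v - polyFun p) =ᵐ[volume.restrict U] weakGrad U v - gradient (polyFun p) :=
  (hv.sub (inH1_polyFun hU p)).isWeakGrad.ae_eq hUo
    (hv.isWeakGrad.sub hv.1 (inH1_polyFun hU p).1 (isWeakGrad_polyFun hU p))

lemma HasPolyLaplacian.sub_polyFun (hUo : IsOpen U) (hU : Bornology.IsBounded U) {v : E N → ℝ}
    (hv : InH1 U v) {m : ℤ} (hL : HasPolyLaplacian U m v) {k : ℤ} {p : MvPolynomial (Fin N) ℝ}
    (hp : p ∈ polyDeg N k) (hkm : k - 2 ≤ m) : HasPolyLaplacian U m (v - polyFun p) := by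
  obtain ⟨q, hq, hqφ⟩ := hL
  -- The Laplacian of `p`, of degree at most `k - 2`.
  let lap := ∑ i, MvPolynomial.pderiv i (MvPolynomial.pderiv i p)
  refine ⟨q - lap, Submodule.sub_mem _ hq (Submodule.sum_mem _ fun i _ => ?_), fun φ hφ => ?_⟩
  · exact polyDeg_mono (by linarith) (pderiv_mem_polyDeg (pderiv_mem_polyDeg hp i) i)
  have hgp := (continuous_gradient_polyFun p).memLp_restrict hU 2
  have hgφ : MemLp (gradient φ) 2 (volume.restrict U) := hφ.memLp_gradient 2
  have h1 : ∫ x in U, inner ℝ (weakGrad U (v - polyFun p) x) (gradient φ x) =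
      (∫ x in U, inner ℝ (weakGrad U v x) (gradient φ x)) -
        ∫ x in U, inner ℝ (gradient (polyFun p) x) (gradient φ x) := by
    rw [← integral_sub (integrable_inner_of_memLp hv.isWeakGrad.1 hgφ)
      (integrable_inner_of_memLp hgp hgφ)]
    refine integral_congr_ae ?_
    filter_upwards [weakGrad_sub_polyFun hUo hU hv p] with x hx
    rw [hx, Pi.sub_apply, inner_sub_left]
  have hint : ∀ r : MvPolynomial (Fin N) ℝ, Integrable (fun x => polyFun r x * φ x)
      (volume.restrict U) := fun r =>
    integrable_smul_of_memLp ((continuous_polyFun r).memLp_restrict hU 2) (hφ.memLp 2)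
  have h2 : ∫ x in U, inner ℝ (gradient (polyFun p) x) (gradient φ x) =
      - ∫ x in U, polyFun lap x * φ x := by
    have e1 : ∀ x, inner ℝ (gradient (polyFun p) x) (gradient φ x) =
        ∑ i, polyFun (MvPolynomial.pderiv i p) x * fderiv ℝ φ x (EuclideanSpace.single i 1) := by
      intro x
      rw [PiLp.inner_apply]
      refine Finset.sum_congr rfl fun i _ => ?_
      rw [← gradient_polyFun_apply, ← gradient_apply]
      simp [mul_comm]
    have e2 : ∀ x, polyFun lap x * φ x =
        ∑ i, polyFun (MvPolynomial.pderiv i (MvPolynomial.pderiv i p)) x * φ x := by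
      intro x
      rw [polyFun_sum, Finset.sum_mul]
    simp only [e1, e2]
    rw [integral_finsetSum _ (fun i _ => ?_), integral_finsetSum _ (fun i _ => hint _),
      ← Finset.sum_neg_distrib]
    · refine Finset.sum_congr rfl fun i _ => ?_
      rw [integral_mul_fderiv_test (contDiff_polyFun _) hφ]
      simp only [← gradient_apply, gradient_polyFun_apply]
    · simp only [← gradient_apply]
      refine integrable_smul_of_memLp ((continuous_polyFun _).memLp_restrict hU 2) ?_
      exact hgφ.continuousLinearMap_comp (EuclideanSpace.proj (𝕜 := ℝ) i : E N →L[ℝ] ℝ)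
  rw [h1, h2, hqφ φ hφ]
  simp only [polyFun_sub, sub_mul]
  rw [integral_sub (hint _) (hint _)]
  ring

end WeakGrad

/-! ### Geometry of tessellations -/

/-- In positive dimension the whole space is unbounded, and only `∅` and the whole space have empty
frontier. This ensures that elements and the domain do have faces. -/
lemma frontier_nonempty_of_isBounded {N : ℕ} {U : Set (E (N + 1))} (hU : Bornology.IsBounded U)
    (hne : U.Nonempty) : (frontier U).Nonempty := by
  rw [nonempty_frontier_iff]
  refine ⟨hne, fun h => ?_⟩
  rw [h] at hU
  exact NormedSpace.unbounded_univ ℝ (E (N + 1)) hU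

lemma volume_real_pos {N : ℕ} {U : Set (E N)} (hU : Bornology.IsBounded U)
    (hUo : IsOpen U) (hne : U.Nonempty) : 0 < (volume : Measure (E N)).real U :=
  ENNReal.toReal_pos (hUo.measure_pos volume hne).ne' hU.measure_lt_top.ne

namespace Mesh

variable {n : ℕ} {M : Mesh n}

lemma mem_facesOf {K : Fin M.numElt} {f : Fin M.numFace} :
    f ∈ M.facesOf K ↔ M.closedFace f ⊆ frontier (M.elt K) := by
  classical
  simp [facesOf]

lemma faceParam_mem_closedFace {f : Fin M.numFace} {y : E n} (hy : y ∈ M.faceDom f) :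
    M.faceParam f y ∈ M.closedFace f := ⟨y, subset_closure hy, rfl⟩

/-- The restriction of a polynomial to a face is a polynomial in the face coordinates. -/
lemma exists_polyFun_faceParam (f : Fin M.numFace) {k : ℕ} {p : MvPolynomial (Fin (n + 1)) ℝ}
    (hp : p ∈ polyDeg (n + 1) k) :
    ∃ q ∈ polyDeg n k, (fun y => polyFun p (M.faceParam f y)) = polyFun q := by
  obtain ⟨q, hq, h⟩ := exists_polyFun_comp_affine (M.faceParam f).toAffineMap hp
  exact ⟨q, hq, funext fun y => (h y).symm⟩

namespace IsTessellation

lemma closedFace_adj (hT : M.IsTessellation) (f : Fin M.numFace) :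
    M.closedFace f ⊆ frontier (M.elt (M.adj f)) := mem_facesOf.1 (hT.adj_mem f)

lemma faceParam_mem_closure_elt (hT : M.IsTessellation) (f : Fin M.numFace) {y : E n}
    (hy : y ∈ M.faceDom f) : M.faceParam f y ∈ closure (M.elt (M.adj f)) :=
  frontier_subset_closure (hT.closedFace_adj f (faceParam_mem_closedFace hy))

lemma dist_le_hFace (hT : M.IsTessellation) (f : Fin M.numFace) {x y : E (n + 1)}
    (hx : x ∈ closure (M.elt (M.adj f))) (hy : y ∈ closure (M.elt (M.adj f))) :
    dist x y ≤ M.hFace f := by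
  rw [hFace, hElt, ← Metric.diam_closure]
  exact Metric.dist_le_diam_of_mem (hT.elt_bounded _).closure hx hy

lemma faceDom_subset_closedBall (hT : M.IsTessellation) (f : Fin M.numFace) :
    ∃ y, M.faceDom f ⊆ Metric.closedBall y (M.hFace f) := by
  obtain ⟨y, hy⟩ := hT.face_nonempty f
  refine ⟨y, fun z hz => ?_⟩
  rw [Metric.mem_closedBall, ← (M.faceParam f).dist_map]
  exact hT.dist_le_hFace f (hT.faceParam_mem_closure_elt f hz) (hT.faceParam_mem_closure_elt f hy)

lemma isBounded_faceDom (hT : M.IsTessellation) (f : Fin M.numFace) :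
    Bornology.IsBounded (M.faceDom f) := by
  obtain ⟨y, hy⟩ := hT.faceDom_subset_closedBall f
  exact Metric.isBounded_closedBall.subset hy

lemma hElt_pos (hT : M.IsTessellation) (K : Fin M.numElt) : 0 < M.hElt K := by
  obtain ⟨x, hx⟩ := hT.elt_nonempty K
  refine Metric.diam_pos ?_ (hT.elt_bounded K)
  by_contra h
  rw [Set.not_nontrivial_iff] at h
  have hs : M.elt K = {x} := h.eq_singleton_of_mem hx
  exact not_isOpen_singleton x (hs ▸ hT.elt_open K)

lemma hFace_pos (hT : M.IsTessellation) (f : Fin M.numFace) : 0 < M.hFace f := hT.hElt_pos _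

lemma facesOf_nonempty (hT : M.IsTessellation) (K : Fin M.numElt) : (M.facesOf K).Nonempty := by
  obtain ⟨x, hx⟩ := frontier_nonempty_of_isBounded (hT.elt_bounded K) (hT.elt_nonempty K)
  rw [hT.elt_frontier K, Set.mem_iUnion₂] at hx
  obtain ⟨f, hf, -⟩ := hx
  exact ⟨f, hf⟩

/-- Needed so that nonzero constant multipliers have positive norm. -/
lemma bdFaces_nonempty (hT : M.IsTessellation) : M.bdFaces.Nonempty := by
  have hb : Bornology.IsBounded M.domain :=
    ((Bornology.isBounded_iUnion.2 fun K => (hT.elt_bounded K).closure)).subset interior_subset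
  have hne : M.domain.Nonempty := by
    have K : Fin M.numElt := ⟨0, hT.numElt_pos⟩
    refine (hT.elt_nonempty K).mono ?_
    exact interior_maximal (subset_closure.trans (Set.subset_iUnion (fun K => closure (M.elt K)) K))
      (hT.elt_open K)
  obtain ⟨x, hx⟩ := frontier_nonempty_of_isBounded hb hne
  rw [hT.domain_frontier, Set.mem_iUnion₂] at hx
  obtain ⟨f, hf, -⟩ := hx
  exact ⟨f, hf⟩

lemma faceDom_area_pos (hT : M.IsTessellation) (f : Fin M.numFace) :
    0 < (volume : Measure (E n)).real (M.faceDom f) :=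
  volume_real_pos (hT.isBounded_faceDom f) (hT.face_open f) (hT.face_nonempty f)

lemma memLp_polyFun_face (hT : M.IsTessellation) (f : Fin M.numFace)
    (p : MvPolynomial (Fin (n + 1)) ℝ) (q : ENNReal) :
    MemLp (fun y => polyFun p (M.faceParam f y)) q (volume.restrict (M.faceDom f)) :=
  ((continuous_polyFun p).comp (M.faceParam f).isometry.continuous).memLp_restrict
    (hT.isBounded_faceDom f) q

/-- A function that is continuous on the boundary of an element has integrable powers on each of
its faces. -/
lemma memLp_face (hT : M.IsTessellation) {K : Fin M.numElt} {v : E (n + 1) → ℝ}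
    (hv : ContinuousOn v (frontier (M.elt K))) {f : Fin M.numFace} (hf : f ∈ M.facesOf K)
    (q : ENNReal) : MemLp (fun y => v (M.faceParam f y)) q (volume.restrict (M.faceDom f)) := by
  have hc : ContinuousOn (fun y => v (M.faceParam f y)) (closure (M.faceDom f)) :=
    hv.comp (M.faceParam f).isometry.continuous.continuousOn
      (fun y hy => mem_facesOf.1 hf ⟨y, hy, rfl⟩)
  have hb := hT.isBounded_faceDom f
  have : IsFiniteMeasure (volume.restrict (M.faceDom f)) :=
    ⟨by simpa using hb.measure_lt_top⟩
  obtain ⟨C, hC⟩ := hb.isCompact_closure.exists_bound_of_continuousOn hc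
  refine MemLp.of_bound ?_ C ?_
  · exact (hc.mono subset_closure).aestronglyMeasurable (hT.face_open f).measurableSet
  · exact (ae_restrict_iff' (hT.face_open f).measurableSet).2
      (.of_forall fun x hx => hC x (subset_closure hx))

/-! ### The elliptic projection -/

lemma exists_isEllProj (hT : M.IsTessellation) (k : ℕ) (K : Fin M.numElt) {v : E (n + 1) → ℝ}
    (hv : InH1 (M.elt K) v) : ∃ p, M.IsEllProj k K v p := by
  have hb := hT.elt_bounded K
  let g := hv.isWeakGrad.1.toLp _
  -- Orthogonal projection in `L²` onto the finite dimensional space of gradients of `ℙ_k`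
  -- determines `p` up to a constant.
  let W := LinearMap.range ((gradL2 (M.elt K) hb).domRestrict (polyDeg (n + 1) k))
  obtain ⟨⟨p, hp⟩, hpW⟩ := (W.starProjection_apply_mem g : W.starProjection g ∈ W)
  have horth : ∀ w ∈ polyDeg (n + 1) k, inner ℝ (gradL2 (M.elt K) hb p) (gradL2 (M.elt K) hb w) =
      inner ℝ g (gradL2 (M.elt K) hb w) := by
    intro w hw
    have h1 := W.starProjection_inner_eq_zero g (gradL2 (M.elt K) hb w) ⟨⟨w, hw⟩, rfl⟩
    rw [← hpW, inner_sub_left, sub_eq_zero] at h1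
    exact h1.symm
  let A := ∑ f ∈ M.facesOf K, (volume : Measure (E n)).real (M.faceDom f)
  have hA : 0 < A := Finset.sum_pos (fun f _ => hT.faceDom_area_pos f) (hT.facesOf_nonempty K)
  -- The additive constant that corrects the boundary mean; `A > 0` is the area of the boundary.
  let a := (∑ f ∈ M.facesOf K, M.intFace f v - ∑ f ∈ M.facesOf K, M.intFace f (polyFun p)) / A
  refine ⟨p + MvPolynomial.C a, Submodule.add_mem _ hp (C_mem_polyDeg a k), fun w hw => ?_, ?_⟩
  · simp only [gradient_polyFun_add, gradient_polyFun_C, add_zero]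
    have h2 := horth w hw
    have hw' := (continuous_gradient_polyFun w).memLp_restrict hb 2
    exact (inner_toLp ((continuous_gradient_polyFun p).memLp_restrict hb 2) hw').symm.trans
      (h2.trans (inner_toLp hv.isWeakGrad.1 hw'))
  · have h3 : ∀ f, M.intFace f (polyFun (p + MvPolynomial.C a)) = M.intFace f (polyFun p) +
        a * (volume : Measure (E n)).real (M.faceDom f) := by
      intro f
      have hb' := hT.isBounded_faceDom f
      have hfin : IsFiniteMeasure (volume.restrict (M.faceDom f)) :=
        ⟨by simpa using hb'.measure_lt_top⟩
      simp only [intFace, polyFun_add, polyFun_C]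
      rw [integral_add (memLp_one_iff_integrable.1 (hT.memLp_polyFun_face f p 1))
        (integrable_const _)]
      simp [mul_comm]
    simp only [h3, Finset.sum_add_distrib, ← Finset.mul_sum]
    change _ + a * A = _
    rw [div_mul_cancel₀ _ hA.ne']
    ring

lemma isEllProj_ellProj (hT : M.IsTessellation) (k : ℕ) (K : Fin M.numElt) {v : E (n + 1) → ℝ}
    (hv : InH1 (M.elt K) v) : M.IsEllProj k K v (M.ellProj k K v) := by
  have h := hT.exists_isEllProj k K hv
  rw [ellProj, dif_pos h]
  exact h.choose_spec

/-- Pythagoras: the gradient of `v - p` is orthogonal to gradients of `ℙ_k`, in particular to that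
of `p`. -/
lemma semiSq_eq_add (hT : M.IsTessellation) {k : ℕ} {K : Fin M.numElt} {v : E (n + 1) → ℝ}
    (hv : InH1 (M.elt K) v) {p : MvPolynomial (Fin (n + 1)) ℝ} (hp : M.IsEllProj k K v p) :
    M.semiSq K v = (∫ x in M.elt K, ‖gradient (polyFun p) x‖ ^ 2) +
      M.semiSq K (v - polyFun p) := by
  have hb := hT.elt_bounded K
  have hgp := (continuous_gradient_polyFun p).memLp_restrict hb 2
  have hg := hv.isWeakGrad.1
  have h1 : M.semiSq K (v - polyFun p) = ∫ x in M.elt K,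
      (‖weakGrad (M.elt K) v x‖ ^ 2 - 2 * inner ℝ (weakGrad (M.elt K) v x) (gradient (polyFun p) x)
        + ‖gradient (polyFun p) x‖ ^ 2) := by
    refine integral_congr_ae ?_
    filter_upwards [weakGrad_sub_polyFun (hT.elt_open K) hb hv p] with x hx
    rw [hx, Pi.sub_apply, norm_sub_sq_real]
  have hi1 : Integrable (fun x => ‖weakGrad (M.elt K) v x‖ ^ 2) (volume.restrict (M.elt K)) := by
    simpa [real_inner_self_eq_norm_sq] using integrable_inner_of_memLp hg hg
  have hi2 : Integrable (fun x => ‖gradient (polyFun p) x‖ ^ 2) (volume.restrict (M.elt K)) := by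
    simpa [real_inner_self_eq_norm_sq] using integrable_inner_of_memLp hgp hgp
  have hi3 := integrable_inner_of_memLp hg hgp
  have hi4 : Integrable (fun x => ‖weakGrad (M.elt K) v x‖ ^ 2 -
      2 * inner ℝ (weakGrad (M.elt K) v x) (gradient (polyFun p) x)) (volume.restrict (M.elt K)) :=
    hi1.sub (hi3.const_mul 2)
  rw [h1, integral_add hi4 hi2, integral_sub hi1 (hi3.const_mul 2),
    integral_const_mul, ← hp.2.1 p hp.1]
  simp only [real_inner_self_eq_norm_sq, semiSq]
  ring

lemma isEllProj_sub (hT : M.IsTessellation) {k : ℕ} {K : Fin M.numElt} {v : E (n + 1) → ℝ}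
    (hv : InH1 (M.elt K) v) (hvc : ContinuousOn v (frontier (M.elt K)))
    {p : MvPolynomial (Fin (n + 1)) ℝ} (hp : M.IsEllProj k K v p) :
    M.IsEllProj k K (v - polyFun p) 0 := by
  have hb := hT.elt_bounded K
  refine ⟨Submodule.zero_mem _, fun w hw => ?_, ?_⟩
  · have hgp := (continuous_gradient_polyFun p).memLp_restrict hb 2
    have hgw := (continuous_gradient_polyFun w).memLp_restrict hb 2
    have h1 : ∫ x in M.elt K, inner ℝ (weakGrad (M.elt K) (v - polyFun p) x)
        (gradient (polyFun w) x) = ∫ x in M.elt K,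
        (inner ℝ (weakGrad (M.elt K) v x) (gradient (polyFun w) x) -
          inner ℝ (gradient (polyFun p) x) (gradient (polyFun w) x)) := by
      refine integral_congr_ae ?_
      filter_upwards [weakGrad_sub_polyFun (hT.elt_open K) hb hv p] with x hx
      rw [hx, Pi.sub_apply, inner_sub_left]
    rw [h1, integral_sub (integrable_inner_of_memLp hv.isWeakGrad.1 hgw)
      (integrable_inner_of_memLp hgp hgw), hp.2.1 w hw]
    simp [gradient_polyFun_zero]
  · have h2 : ∀ f ∈ M.facesOf K, M.intFace f (v - polyFun p) =
        M.intFace f v - M.intFace f (polyFun p) := fun f hf =>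
      integral_sub (memLp_one_iff_integrable.1 (hT.memLp_face hvc hf 1))
        (memLp_one_iff_integrable.1 (hT.memLp_polyFun_face f p 1))
    rw [Finset.sum_congr rfl h2, Finset.sum_sub_distrib, hp.2.2, sub_self]
    simp [intFace]

/-! ### Subtracting a polynomial inside the virtual element space -/

lemma hasOwnTrace_sub (hT : M.IsTessellation) {K : Fin M.numElt} {v : E (n + 1) → ℝ}
    (hv : InH1 (M.elt K) v) (ht : M.HasOwnTrace K v) (p : MvPolynomial (Fin (n + 1)) ℝ) :
    M.HasOwnTrace K (v - polyFun p) := by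
  obtain ⟨φ, h1, h2, h3, h4⟩ := ht
  refine ⟨fun m => φ m - polyFun p, fun m => (h1 m).sub (contDiff_polyFun p), ?_, ?_, ?_⟩
  · simpa using h2
  · refine h3.congr fun m => eLpNorm_congr_ae ?_
    filter_upwards [weakGrad_sub_polyFun (hT.elt_open K) (hT.elt_bounded K) hv p] with x hx
    have hg : gradient (φ m - polyFun p) x = gradient (φ m) x - gradient (polyFun p) x := by
      simp only [gradient]
      rw [fderiv_sub ((h1 m).differentiable (by simp) x) (differentiable_polyFun p x), map_sub]
    rw [hx, hg, Pi.sub_apply]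
    abel
  · simpa using h4

lemma isFaceEllProj_sub (hT : M.IsTessellation) {k : ℕ} {f : Fin M.numFace} {v : E (n + 1) → ℝ}
    (he : ∀ e ∈ M.edgesOf f, ∃ p ∈ polyDeg (n + 1) k, ∀ x ∈ M.edge e, v x = polyFun p x)
    (hv : InH1 (M.faceDom f) (fun y => v (M.faceParam f y)))
    {q : MvPolynomial (Fin (n + 1)) ℝ} (hq : M.IsFaceEllProj k f v q)
    {p : MvPolynomial (Fin (n + 1)) ℝ} (hp : p ∈ polyDeg (n + 1) k) :
    M.IsFaceEllProj k f (v - polyFun p) (q - p) := by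
  have hb := hT.isBounded_faceDom f
  obtain ⟨p', -, hpp'⟩ := exists_polyFun_faceParam f hp
  obtain ⟨q', -, hqq'⟩ := exists_polyFun_faceParam f hq.1
  refine ⟨Submodule.sub_mem _ hq.1 hp, fun w hw => ?_, ?_⟩
  · have hgp := (continuous_gradient_polyFun p').memLp_restrict hb 2
    have hgq := (continuous_gradient_polyFun q').memLp_restrict hb 2
    have hgw := (continuous_gradient_polyFun w).memLp_restrict hb 2
    have hqw := hq.2.1 w hw
    have e1 : (fun y => polyFun (q - p) (M.faceParam f y)) = polyFun (q' - p') := by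
      ext y
      rw [polyFun_sub, polyFun_sub, ← hpp', ← hqq']
    have e2 : (fun y => (v - polyFun p) (M.faceParam f y)) =
        (fun y => v (M.faceParam f y)) - polyFun p' := by
      rw [← hpp']; rfl
    rw [hqq'] at hqw
    have h2 : ∫ x in M.faceDom f, inner ℝ (weakGrad (M.faceDom f)
        ((fun y => v (M.faceParam f y)) - polyFun p') x) (gradient (polyFun w) x) =
        ∫ x in M.faceDom f,
        (inner ℝ (weakGrad (M.faceDom f) (fun y => v (M.faceParam f y)) x) (gradient (polyFun w) x) -
          inner ℝ (gradient (polyFun p') x) (gradient (polyFun w) x)) := by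
      refine integral_congr_ae ?_
      filter_upwards [weakGrad_sub_polyFun (hT.face_open f) hb hv p'] with x hx
      rw [hx, Pi.sub_apply, inner_sub_left]
    simp only [e1, e2, gradient_polyFun_sub, inner_sub_left]
    rw [h2, integral_sub (integrable_inner_of_memLp hv.isWeakGrad.1 hgw)
      (integrable_inner_of_memLp hgp hgw), integral_sub (integrable_inner_of_memLp hgq hgw)
      (integrable_inner_of_memLp hgp hgw), hqw]
  · have hcl : ∀ e, Continuous fun t : ℝ =>
        AffineMap.lineMap (M.edgeFst e) (M.edgeSnd e) t := fun e =>
      AffineMap.lineMap_continuous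
    have hi : ∀ e (r : MvPolynomial (Fin (n + 1)) ℝ), IntervalIntegrable (fun t =>
        polyFun r (AffineMap.lineMap (M.edgeFst e) (M.edgeSnd e) t)) volume 0 1 := fun e r =>
      ((continuous_polyFun r).comp (hcl e)).intervalIntegrable _ _
    have h1 : ∀ e, M.intEdge e (polyFun (q - p)) =
        M.intEdge e (polyFun q) - M.intEdge e (polyFun p) := by
      intro e
      simp only [intEdge, polyFun_sub]
      rw [intervalIntegral.integral_sub (hi e q) (hi e p)]
      ring
    have h2 : ∀ e ∈ M.edgesOf f, M.intEdge e (v - polyFun p) =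
        M.intEdge e v - M.intEdge e (polyFun p) := by
      intro e hef
      -- On an edge `v` coincides with a polynomial, which supplies the integrability needed to
      -- split the integral.
      obtain ⟨r, -, hr⟩ := he e hef
      have hmem : ∀ t ∈ Set.uIcc (0 : ℝ) 1,
          v (AffineMap.lineMap (M.edgeFst e) (M.edgeSnd e) t) =
          polyFun r (AffineMap.lineMap (M.edgeFst e) (M.edgeSnd e) t) := by
        intro t ht
        rw [Set.uIcc_of_le zero_le_one] at ht
        refine hr _ ?_
        rw [edge, segment_eq_image_lineMap]
        exact ⟨t, ht, rfl⟩
      simp only [intEdge, Pi.sub_apply]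
      rw [intervalIntegral.integral_congr (fun t ht => by rw [hmem t ht]),
        intervalIntegral.integral_congr (g := fun t => polyFun r
          (AffineMap.lineMap (M.edgeFst e) (M.edgeSnd e) t)) hmem,
        intervalIntegral.integral_sub (hi e r) (hi e p)]
      ring
    rw [Finset.sum_congr rfl h2, Finset.sum_congr rfl fun e _ => h1 e, Finset.sum_sub_distrib,
      Finset.sum_sub_distrib, hq.2.2]

lemma inFaceSpace_sub (hT : M.IsTessellation) {k : ℕ} {B : Fin M.numFace → NestedBases n k}
    {f : Fin M.numFace} {v : E (n + 1) → ℝ} (hv : M.InFaceSpace k B f v)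
    {p : MvPolynomial (Fin (n + 1)) ℝ} (hp : p ∈ polyDeg (n + 1) k) :
    M.InFaceSpace k B f (v - polyFun p) := by
  refine ⟨fun hn => ?_, fun hn => ?_⟩
  · obtain ⟨q, hq, h⟩ := hv.1 hn
    exact ⟨q - p, Submodule.sub_mem _ hq hp, fun x hx => by simp [h x hx]⟩
  obtain ⟨hc, he, hH, hL, q, hq, hmom⟩ := hv.2 hn
  have hb := hT.isBounded_faceDom f
  obtain ⟨p', hp', hpp'⟩ := exists_polyFun_faceParam f hp
  have e2 : (fun y => (v - polyFun p) (M.faceParam f y)) =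
      (fun y => v (M.faceParam f y)) - polyFun p' := by
    rw [← hpp']; rfl
  refine ⟨hc.sub (continuous_polyFun p).continuousOn, fun e hef => ?_, ?_, ?_, q - p,
    hT.isFaceEllProj_sub he hH hq hp, fun r hr => ?_⟩
  · obtain ⟨r, hr, h⟩ := he e hef
    exact ⟨r - p, Submodule.sub_mem _ hr hp, fun x hx => by simp [h x hx]⟩
  · rw [e2]
    exact hH.sub (inH1_polyFun hb p')
  · rw [e2]
    exact hL.sub_polyFun (hT.face_open f) hb hH hp' (by linarith)
  · have hr2 := (continuous_polyFun r).memLp_restrict hb 2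
    have i1 := integrable_smul_of_memLp hr2 hH.1
    have i2 := integrable_smul_of_memLp hr2 (hT.memLp_polyFun_face f p 2)
    have i3 := integrable_smul_of_memLp hr2 (hT.memLp_polyFun_face f q 2)
    simp only [smul_eq_mul] at i1 i2 i3
    simp only [Pi.sub_apply, polyFun_sub, mul_sub]
    rw [integral_sub i1 i2, integral_sub i3 i2, hmom r hr]

/-- Together with `isEllProj_sub` this makes `u - Π^∇ u` an admissible argument for the bounds on
the stabilizing form. -/
lemma inEltSpace_sub (hT : M.IsTessellation) {k : ℕ} {B : Fin M.numFace → NestedBases n k}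
    {K : Fin M.numElt} {v : E (n + 1) → ℝ} (hv : M.InEltSpace k B K v)
    {p : MvPolynomial (Fin (n + 1)) ℝ} (hp : p ∈ polyDeg (n + 1) k) :
    M.InEltSpace k B K (v - polyFun p) :=
  ⟨hv.1.sub (inH1_polyFun (hT.elt_bounded K) p), hT.hasOwnTrace_sub hv.1 hv.2.1 p,
    hv.2.2.1.sub (continuous_polyFun p).continuousOn,
    fun f hf => hT.inFaceSpace_sub (hv.2.2.2.1 f hf) hp,
    hv.2.2.2.2.sub_polyFun (hT.elt_open K) (hT.elt_bounded K) hv.1 hp le_rfl⟩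

end IsTessellation

end Mesh

/-! ### Inverse trace estimates and the boundary correction -/

lemma exists_volume_closedBall_le (N : ℕ) : ∃ V : ℝ, 0 ≤ V ∧ ∀ (y : E N) (r : ℝ), 0 ≤ r →
    (volume : Measure (E N)).real (Metric.closedBall y r) ≤ V * r ^ N := by
  refine ⟨(volume : Measure (E N)).real (Metric.ball 0 1), measureReal_nonneg, fun y r hr => ?_⟩
  rw [Measure.real, Measure.addHaar_closedBall _ _ hr, ENNReal.toReal_mul,
    ENNReal.toReal_ofReal (by positivity), finrank_euclideanSpace_fin, mul_comm]
  rfl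

/-- Recovers the Cauchy–Schwarz form from all weighted Young inequalities: the quadratic `A² t² - 2
x t + B²` is nonnegative, so its discriminant is not positive. This covers `A = 0` and `B = 0`,
where no optimal weight exists. -/
lemma le_mul_of_forall_weighted {x A B : ℝ} (hx : 0 ≤ x) (hA : 0 ≤ A) (hB : 0 ≤ B)
    (h : ∀ t : ℝ, 0 < t → 2 * x ≤ t * A ^ 2 + B ^ 2 / t) : x ≤ A * B := by
  have h1 : ∀ t : ℝ, 0 ≤ A ^ 2 * (t * t) + (-2 * x) * t + B ^ 2 := by
    intro t
    rcases le_or_gt t 0 with ht | ht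
    · nlinarith [mul_nonneg hx (neg_nonneg.2 ht), sq_nonneg (A * t), sq_nonneg B]
    · have h2 := mul_le_mul_of_nonneg_right (h t ht) ht.le
      rw [add_mul, div_mul_cancel₀ _ ht.ne'] at h2
      nlinarith
  have h2 := discrim_le_zero h1
  rw [discrim] at h2
  exact abs_le_of_sq_le_sq' (by nlinarith) (mul_nonneg hA hB) |>.2

namespace Mesh

variable {n : ℕ} {M : Mesh n}

lemma ellProj_mem (k : ℕ) (K : Fin M.numElt) (v : E (n + 1) → ℝ) :
    M.ellProj k K v ∈ polyDeg (n + 1) k := by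
  rw [ellProj]
  split_ifs with h
  · exact h.choose_spec.1
  · exact Submodule.zero_mem _

/-- The square of the broken seminorm of the elliptic projection. -/
def projSq (M : Mesh n) (k : ℕ) (u : E (n + 1) → ℝ) : ℝ :=
  ∑ K, ∫ x in M.elt K, ‖gradient (polyFun (M.ellProj k K u)) x‖ ^ 2

lemma projSq_nonneg (k : ℕ) (u : E (n + 1) → ℝ) : 0 ≤ M.projSq k u :=
  Finset.sum_nonneg fun _ _ => integral_nonneg fun _ => by positivity

lemma sq_normNegHalf (hT : M.IsTessellation) (μ : E (n + 1) → ℝ) :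
    M.normNegHalf μ ^ 2 = ∑ f ∈ M.bdFaces, M.hFace f * M.intFace f fun x => μ x ^ 2 :=
  Real.sq_sqrt (Finset.sum_nonneg fun f _ => mul_nonneg (hT.hFace_pos f).le
    (integral_nonneg fun _ => by positivity))

/-- Grouping the boundary faces by adjacent element, each element occurs at most `N₀` times. -/
lemma sum_adj_le {γ₀ : ℝ} {N₀ : ℕ} (hT : M.IsTessellation) (hS : M.ShapeRegular γ₀ N₀)
    {I : Fin M.numElt → ℝ} (hI : ∀ K, 0 ≤ I K) :
    ∑ f ∈ M.bdFaces, I (M.adj f) ≤ N₀ * ∑ K, I K := by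
  classical
  rw [← Finset.sum_fiberwise M.bdFaces M.adj, Finset.mul_sum]
  refine Finset.sum_le_sum fun K _ => ?_
  rw [Finset.sum_congr rfl (g := fun _ => I K) fun f hf => by rw [(Finset.mem_filter.1 hf).2],
    Finset.sum_const, nsmul_eq_mul]
  refine mul_le_mul_of_nonneg_right (Nat.cast_le.2 ((Finset.card_le_card fun f hf => ?_).trans
    (hS.card_faces K))) (hI K)
  rw [← (Finset.mem_filter.1 hf).2]
  exact hT.adj_mem f

/-- Inverse trace estimate for the directional derivatives of a polynomial on a face. -/
lemma exists_face_inverse_estimate (n k : ℕ) {γ₀ : ℝ} (hγ₀ : 0 < γ₀) :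
    ∃ C : ℝ, 0 ≤ C ∧ ∀ (M : Mesh n) (N₀ : ℕ), M.IsTessellation → M.ShapeRegular γ₀ N₀ →
      ∀ f, ∀ p ∈ polyDeg (n + 1) k, ∃ b : ℝ, 0 ≤ b ∧
        b * (volume : Measure (E n)).real (M.faceDom f) ≤
          C * M.hFace f * ∫ x in M.elt (M.adj f), ‖gradient (polyFun p) x‖ ^ 2 ∧
        ∀ j ∈ Finset.Icc 1 k, ∀ s : E (n + 1), ‖s‖ = 1 → ∀ y ∈ M.faceDom f,
          (M.hFace f ^ j * dirDeriv j s p (M.faceParam f y)) ^ 2 ≤ b := by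
  obtain ⟨C, hC0, hC⟩ := exists_inverse_estimate (N := n + 1) k hγ₀
  obtain ⟨V, hV0, hV⟩ := exists_volume_closedBall_le n
  refine ⟨C * V, mul_nonneg hC0 hV0, fun M N₀ hT hS f p hp => ?_⟩
  have hh := hT.hFace_pos f
  set h := M.hFace f with hdef
  set I := ∫ x in M.elt (M.adj f), ‖gradient (polyFun p) x‖ ^ 2 with hI
  have hI0 : 0 ≤ I := integral_nonneg fun _ => by positivity
  -- A pointwise bound `b`, constant on the face. The face lies in a ball of radius `h` in `ℝ^n`, so
  -- its area is at most `V h ^ n` and `b` times the area scales like `h`.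
  refine ⟨C * h ^ 2 * I / h ^ (n + 1), by positivity, ?_, fun j hj s hs y hy => ?_⟩
  · obtain ⟨z, hz⟩ := hT.faceDom_subset_closedBall f
    have h1 : (volume : Measure (E n)).real (M.faceDom f) ≤ V * h ^ n :=
      (measureReal_mono hz measure_closedBall_lt_top.ne).trans (hV z h hh.le)
    calc _ ≤ C * h ^ 2 * I / h ^ (n + 1) * (V * h ^ n) := by gcongr
      _ = _ := by field_simp; ring
  · obtain ⟨c, ρ, hρ, hstar⟩ := hS.elt_star (M.adj f)
    -- A nonempty set contains each point with respect to which it is star shaped.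
    have hball : Metric.ball c ρ ⊆ M.elt (M.adj f) := fun z hz =>
      (hstar z hz).mem (hT.elt_nonempty _)
    have hρ0 : 0 < ρ := lt_of_lt_of_le (mul_pos hγ₀ hh) hρ
    rw [le_div_iff₀ (by positivity)]
    refine hC _ c h hh (hT.elt_bounded _) ((Metric.ball_subset_ball hρ).trans hball) j hj s hs _ ?_
      p hp
    exact hT.dist_le_hFace f (hT.faceParam_mem_closure_elt f hy)
      (subset_closure (hball (Metric.mem_ball_self hρ0)))

lemma delta_nonneg {N : ℕ} (Ω : Set (E N)) (s x : E N) : 0 ≤ delta Ω s x :=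
  Real.sInf_nonneg fun _ ht => ht.1

lemma isFiniteMeasure_face (hT : M.IsTessellation) (f : Fin M.numFace) :
    IsFiniteMeasure ((volume : Measure (E n)).restrict (M.faceDom f)) :=
  ⟨by simpa using (hT.isBounded_faceDom f).measure_lt_top⟩

lemma memLp_of_mem_spaceΛ (hT : M.IsTessellation) {k' : ℕ} {μ : E (n + 1) → ℝ}
    (hμ : μ ∈ M.spaceΛ k') {f : Fin M.numFace} (hf : f ∈ M.bdFaces) (q : ENNReal) :
    MemLp (fun y => μ (M.faceParam f y)) q (volume.restrict (M.faceDom f)) := by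
  obtain ⟨p, -, hp⟩ := hμ f hf
  refine MemLp.ae_eq ?_ ((continuous_polyFun p).memLp_restrict (hT.isBounded_faceDom f) q)
  exact (ae_restrict_iff' (hT.face_open f).measurableSet).2 (.of_forall fun y hy => (hp y hy).symm)

/-- Here `j ≥ 1` and `τ < 1` give `τ ^ j ≤ τ`. The Young weights `t / h` and `h / t` are chosen so
that, after integration over the face, the first term loses its power of `h` and the second carries
the weight of `‖μ‖²_{-1/2,h}`. -/
lemma abs_correction_le {τ h t δ D m b : ℝ} {j : ℕ} (hτ : 0 < τ) (hτ1 : τ < 1) (hh : 0 < h)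
    (ht : 0 < t) (hj : 1 ≤ j) (hδ0 : 0 ≤ δ) (hδ : δ ≤ τ * h) (hD : (h ^ j * D) ^ 2 ≤ b) :
    ‖δ ^ j / (j.factorial : ℝ) * D * m‖ ≤ τ / 2 * (t / h * b + h / t * m ^ 2) := by
  have h1 : δ ^ j / (j.factorial : ℝ) ≤ τ * h ^ j := by
    calc δ ^ j / (j.factorial : ℝ) ≤ δ ^ j :=
          div_le_self (by positivity) (by exact_mod_cast Nat.factorial_pos j)
      _ ≤ (τ * h) ^ j := by gcongr
      _ = τ ^ j * h ^ j := mul_pow _ _ _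
      _ ≤ τ * h ^ j := by
        gcongr
        exact pow_le_of_le_one hτ.le hτ1.le (by omega)
  have h2 : ‖δ ^ j / (j.factorial : ℝ) * D * m‖ ≤ τ * (|h ^ j * D| * |m|) := by
    rw [Real.norm_eq_abs, abs_mul, abs_mul, abs_of_nonneg (by positivity : 0 ≤ δ ^ j / (j.factorial : ℝ)),
      abs_mul, abs_of_pos (pow_pos hh j)]
    calc _ ≤ τ * h ^ j * |D| * |m| := by gcongr
      _ = _ := by ring
  have h3 : 2 * (|h ^ j * D| * |m|) ≤ t / h * (h ^ j * D) ^ 2 + h / t * m ^ 2 := by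
    have e : t / h * (h ^ j * D) ^ 2 + h / t * m ^ 2 - 2 * (|h ^ j * D| * |m|) =
        t / h * (|h ^ j * D| - h / t * |m|) ^ 2 := by
      rw [← sq_abs (h ^ j * D), ← sq_abs m]
      field_simp
      ring
    have : 0 ≤ t / h * (|h ^ j * D| - h / t * |m|) ^ 2 := by positivity
    linarith
  have h4 : t / h * (h ^ j * D) ^ 2 ≤ t / h * b := by gcongr
  calc _ ≤ _ := h2
    _ = τ / 2 * (2 * (|h ^ j * D| * |m|)) := by ring
    _ ≤ _ := by gcongr; linarith

/-- Boundedness of the boundary correction. -/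
lemma exists_abs_formC_le (n k : ℕ) {γ₀ : ℝ} (hγ₀ : 0 < γ₀) (N₀ : ℕ) :
    ∃ C : ℝ, 0 < C ∧ ∀ (M : Mesh n) (Ω : Set (E (n + 1))) (σ : Fin M.numFace → E (n + 1))
      (τ : ℝ) (k' kStar : ℕ), 0 < τ → τ < 1 → M.IsTessellation → M.ShapeRegular γ₀ N₀ →
      M.IsApproximation Ω σ τ → kStar ≤ k → ∀ u, ∀ μ ∈ M.spaceΛ k',
        |M.formC k kStar Ω σ u μ| ≤ C * τ * √(M.projSq k u) * M.normNegHalf μ := by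
  obtain ⟨C, hC0, hC⟩ := exists_face_inverse_estimate n k hγ₀
  -- The factor `k` bounds the number of Taylor terms; the summand `1` makes the constant positive,
  -- as the division by it in `τ_α` requires.
  refine ⟨k * √(C * N₀) + 1, by positivity, fun M Ω σ τ k' kStar hτ hτ1 hT hS hA hk u μ hμ => ?_⟩
  have hX0 := projSq_nonneg (M := M) k u
  have hm0 : 0 ≤ M.normNegHalf μ := Real.sqrt_nonneg _
  let I : Fin M.numElt → ℝ := fun K => ∫ x in M.elt K, ‖gradient (polyFun (M.ellProj k K u)) x‖ ^ 2
  have hI0 : ∀ K, 0 ≤ I K := fun K => integral_nonneg fun _ => by positivity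
  have hterm : ∀ t : ℝ, 0 < t → ∀ f ∈ M.bdFaces, ∀ j ∈ Finset.Icc 1 kStar,
      |M.intFace f fun x => delta Ω (σ f) x ^ j / (j.factorial : ℝ) *
        dirDeriv j (σ f) (M.ellProj k (M.adj f) u) x * μ x| ≤
      τ / 2 * (t * C * I (M.adj f) + M.hFace f * (M.intFace f fun x => μ x ^ 2) / t) := by
    intro t ht f hf j hj
    rw [Finset.mem_Icc] at hj
    obtain ⟨b, hb0, hb, hbp⟩ := hC M N₀ hT hS f _ (M.ellProj_mem k (M.adj f) u)
    have hh := hT.hFace_pos f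
    have hfin := isFiniteMeasure_face hT f
    have hμi : Integrable (fun y => μ (M.faceParam f y) ^ 2) (volume.restrict (M.faceDom f)) :=
      (memLp_of_mem_spaceΛ hT hμ hf 2).integrable_sq
    have hi1 : Integrable (fun _ : E n => t / M.hFace f * b) (volume.restrict (M.faceDom f)) :=
      integrable_const _
    have hi2 : Integrable (fun y => M.hFace f / t * μ (M.faceParam f y) ^ 2)
        (volume.restrict (M.faceDom f)) := hμi.const_mul _
    -- Only the majorant has to be integrable, so no measurability of `δ` along the face enters.
    have h1 := norm_integral_le_of_norm_le (μ := volume.restrict (M.faceDom f))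
      (f := fun y => delta Ω (σ f) (M.faceParam f y) ^ j / (j.factorial : ℝ) *
        dirDeriv j (σ f) (M.ellProj k (M.adj f) u) (M.faceParam f y) * μ (M.faceParam f y))
      ((hi1.add hi2).const_mul (τ / 2))
      ((ae_restrict_iff' (hT.face_open f).measurableSet).2 (.of_forall fun y hy =>
        abs_correction_le hτ hτ1 hh ht hj.1 (delta_nonneg _ _ _)
          (hA.delta_le f hf _ (faceParam_mem_closedFace hy))
          (hbp j (Finset.mem_Icc.2 ⟨hj.1, hj.2.trans hk⟩) _ (hA.norm_dir f hf) y hy)))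
    refine h1.trans ?_
    simp only [Pi.add_apply]
    rw [integral_const_mul, integral_add hi1 hi2, integral_const_mul (M.hFace f / t)]
    refine mul_le_mul_of_nonneg_left (add_le_add ?_ (le_of_eq ?_)) (by positivity)
    · rw [integral_const, smul_eq_mul, measureReal_restrict_apply_univ]
      calc _ = t / M.hFace f * (b * (volume : Measure (E n)).real (M.faceDom f)) := by ring
        _ ≤ t / M.hFace f * (C * M.hFace f * I (M.adj f)) := by gcongr
        _ = _ := by field_simp
    · rw [intFace]; ring
  have hsum : ∀ t : ℝ, 0 < t → 2 * |M.formC k kStar Ω σ u μ| ≤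
      τ * k * (t * (C * N₀ * M.projSq k u) + M.normNegHalf μ ^ 2 / t) := by
    intro t ht
    have h1 : |M.formC k kStar Ω σ u μ| ≤ ∑ f ∈ M.bdFaces, k *
        (τ / 2 * (t * C * I (M.adj f) + M.hFace f * (M.intFace f fun x => μ x ^ 2) / t)) := by
      refine (Finset.abs_sum_le_sum_abs _ _).trans (Finset.sum_le_sum fun f hf => ?_)
      refine (Finset.abs_sum_le_sum_abs _ _).trans ((Finset.sum_le_sum (hterm t ht f hf)).trans ?_)
      rw [Finset.sum_const, Nat.card_Icc, nsmul_eq_mul, Nat.add_sub_cancel]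
      have hq : 0 ≤ M.intFace f fun x => μ x ^ 2 := integral_nonneg fun _ => by positivity
      have := hI0 (M.adj f)
      have := hT.hFace_pos f
      gcongr
    have h2 : ∑ f ∈ M.bdFaces, (k : ℝ) *
        (τ / 2 * (t * C * I (M.adj f) + M.hFace f * (M.intFace f fun x => μ x ^ 2) / t)) =
        k * (τ / 2) * (t * C * ∑ f ∈ M.bdFaces, I (M.adj f) + M.normNegHalf μ ^ 2 / t) := by
      rw [sq_normNegHalf hT, Finset.mul_sum, Finset.sum_div, ← Finset.sum_add_distrib,
        Finset.mul_sum]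
      exact Finset.sum_congr rfl fun _ _ => by ring
    rw [h2] at h1
    have h3 : t * C * ∑ f ∈ M.bdFaces, I (M.adj f) ≤ t * (C * N₀ * M.projSq k u) := by
      calc _ ≤ t * C * (N₀ * ∑ K, I K) :=
            mul_le_mul_of_nonneg_left (sum_adj_le hT hS hI0) (by positivity)
        _ = _ := by rw [projSq]; ring
    have h4 : (k : ℝ) * (τ / 2) * (t * C * ∑ f ∈ M.bdFaces, I (M.adj f) +
        M.normNegHalf μ ^ 2 / t) ≤ k * (τ / 2) * (t * (C * N₀ * M.projSq k u) +
          M.normNegHalf μ ^ 2 / t) := by gcongr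
    linarith
  have hτk : 0 ≤ τ * k := by positivity
  have h5 : |M.formC k kStar Ω σ u μ| ≤
      (τ * k * √(C * N₀ * M.projSq k u)) * M.normNegHalf μ := by
    have hA' : 0 ≤ √(τ * k * (C * N₀ * M.projSq k u)) := Real.sqrt_nonneg _
    have hB' : 0 ≤ √(τ * k) * M.normNegHalf μ := by positivity
    -- The weight `t` was the same on all faces and for all orders, so Cauchy–Schwarz is recovered
    -- once, for the whole sum.
    have h6 := le_mul_of_forall_weighted (abs_nonneg _) hA' hB' fun t ht => by
      rw [Real.sq_sqrt (by positivity), mul_pow, Real.sq_sqrt hτk]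
      refine (hsum t ht).trans (le_of_eq ?_)
      ring
    refine h6.trans (le_of_eq ?_)
    rw [Real.sqrt_mul hτk]
    calc _ = (√(τ * k) * √(τ * k)) * √(C * N₀ * M.projSq k u) * M.normNegHalf μ := by ring
      _ = _ := by rw [Real.mul_self_sqrt hτk]
  refine h5.trans ?_
  rw [Real.sqrt_mul (by positivity)]
  have : τ * k * (√(C * N₀) * √(M.projSq k u)) ≤
      (k * √(C * N₀) + 1) * τ * √(M.projSq k u) := by
    have : 0 ≤ τ * √(M.projSq k u) := by positivity
    nlinarith
  gcongr

/-- Inverse trace estimate for the normal derivative of the elliptic projection. -/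
lemma exists_normalDeriv_le (n k : ℕ) (hk : 1 ≤ k) {γ₀ : ℝ} (hγ₀ : 0 < γ₀) (N₀ : ℕ) :
    ∃ C : ℝ, 0 ≤ C ∧ ∀ (M : Mesh n), M.IsTessellation → M.ShapeRegular γ₀ N₀ → ∀ u,
      ∑ f ∈ M.bdFaces, M.hFace f * M.intFace f (fun x => M.normalDeriv k f u x ^ 2) ≤
        C * M.projSq k u := by
  obtain ⟨C, hC0, hC⟩ := exists_face_inverse_estimate n k hγ₀
  refine ⟨C * N₀, by positivity, fun M hT hS u => ?_⟩
  let I : Fin M.numElt → ℝ := fun K => ∫ x in M.elt K, ‖gradient (polyFun (M.ellProj k K u)) x‖ ^ 2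
  have hI0 : ∀ K, 0 ≤ I K := fun K => integral_nonneg fun _ => by positivity
  have h1 : ∀ f ∈ M.bdFaces, M.hFace f * M.intFace f (fun x => M.normalDeriv k f u x ^ 2) ≤
      C * I (M.adj f) := by
    intro f hf
    have hh := hT.hFace_pos f
    have hfin := isFiniteMeasure_face hT f
    obtain ⟨b, hb0, hb, hbp⟩ := hC M N₀ hT hS f _ (M.ellProj_mem k (M.adj f) u)
    have h2 : M.intFace f (fun x => M.normalDeriv k f u x ^ 2) ≤
        ∫ _ in M.faceDom f, b / M.hFace f ^ 2 := by
      refine integral_mono_of_nonneg (.of_forall fun _ => by positivity) (integrable_const _) ?_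
      refine (ae_restrict_iff' (hT.face_open f).measurableSet).2 (.of_forall fun y hy => ?_)
      have := hbp 1 (Finset.mem_Icc.2 ⟨le_rfl, hk⟩) _ (hT.normal_norm f hf) y hy
      rw [dirDeriv_one, pow_one, mul_pow, mul_comm] at this
      exact (le_div_iff₀ (by positivity)).2 this
    rw [integral_const, smul_eq_mul, measureReal_restrict_apply_univ] at h2
    calc _ ≤ M.hFace f * ((volume : Measure (E n)).real (M.faceDom f) * (b / M.hFace f ^ 2)) := by
          gcongr
      _ = (b * (volume : Measure (E n)).real (M.faceDom f)) / M.hFace f := by field_simp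
      _ ≤ (C * M.hFace f * I (M.adj f)) / M.hFace f := by gcongr
      _ = _ := by field_simp
  refine (Finset.sum_le_sum h1).trans ?_
  rw [← Finset.mul_sum, mul_assoc]
  exact mul_le_mul_of_nonneg_left (sum_adj_le hT hS hI0) hC0

end Mesh

/-! ### Pointwise and integrated inequalities on a face -/

section Scalar

variable {α : Type*} [MeasurableSpace α] {ν : Measure α} {r g b : α → ℝ}

/-- With `r = λ`, `g = ∂_ν Π^∇ u`, `b = h⁻¹ Π⁰ u`, the choice of sign gives `(r + g)(g - r) = g² -
r²` without a mixed term. The rest, `ε b (r + g)`, is bounded using the squares of `r - b/2` and `g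
- b/2`. -/
lemma integral_stabilization_le (hr : MemLp r 2 ν) (hg : MemLp g 2 ν) (hb : MemLp b 2 ν) {ε : ℝ}
    (hε : 0 ≤ ε) :
    ∫ x, (r x + g x) * (-r x + ε * b x + g x) ∂ν ≤
      (1 + ε) * (∫ x, g x ^ 2 ∂ν) - (1 - ε) * (∫ x, r x ^ 2 ∂ν) + ε / 2 * ∫ x, b x ^ 2 ∂ν := by
  have ig := hg.integrable_sq.const_mul (1 + ε)
  have ir := hr.integrable_sq.const_mul (1 - ε)
  have ib := hb.integrable_sq.const_mul (ε / 2)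
  have igr : Integrable (fun x => (1 + ε) * g x ^ 2 - (1 - ε) * r x ^ 2) ν := ig.sub ir
  rw [← integral_const_mul, ← integral_const_mul, ← integral_const_mul, ← integral_sub ig ir,
    ← integral_add igr ib]
  refine integral_mono ?_ (igr.add ib) fun x => ?_
  · exact (hr.add hg).integrable_mul ((hr.neg.add (hb.const_mul ε)).add hg)
  · nlinarith [mul_nonneg hε (sq_nonneg (r x - b x / 2)), mul_nonneg hε (sq_nonneg (g x - b x / 2))]

/-- Young with weight `6`: the factor `7/6` is close enough to `1` for the `λ` terms in
`stability_arith` to keep a positive balance. -/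
lemma integral_sq_le (hr : MemLp r 2 ν) (hb : MemLp b 2 ν) (ε : ℝ) :
    ∫ x, (-r x + ε * b x) ^ 2 ∂ν ≤ 7 / 6 * (∫ x, r x ^ 2 ∂ν) + 7 * ε ^ 2 * ∫ x, b x ^ 2 ∂ν := by
  have ir := hr.integrable_sq.const_mul (7 / 6)
  have ib := hb.integrable_sq.const_mul (7 * ε ^ 2)
  rw [← integral_const_mul, ← integral_const_mul, ← integral_add ir ib]
  refine integral_mono (hr.neg.add (hb.const_mul ε)).integrable_sq (ir.add ib) fun x => ?_
  change (-r x + ε * b x) ^ 2 ≤ 7 / 6 * r x ^ 2 + 7 * ε ^ 2 * b x ^ 2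
  nlinarith [sq_nonneg (r x + 6 * (ε * b x))]

/-- Used to show that the test pair has positive norm: if `μ` and `Π⁰ u` have norm zero, so has `λ`.
-/
lemma le_integral_sq (hr : MemLp r 2 ν) (hb : MemLp b 2 ν) (ε : ℝ) :
    1 / 2 * (∫ x, r x ^ 2 ∂ν) - ε ^ 2 * ∫ x, b x ^ 2 ∂ν ≤ ∫ x, (-r x + ε * b x) ^ 2 ∂ν := by
  have ir := hr.integrable_sq.const_mul (1 / 2)
  have ib := hb.integrable_sq.const_mul (ε ^ 2)
  rw [← integral_const_mul, ← integral_const_mul, ← integral_sub ir ib]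
  refine integral_mono (ir.sub ib) (hr.neg.add (hb.const_mul ε)).integrable_sq fun x => ?_
  change 1 / 2 * r x ^ 2 - ε ^ 2 * b x ^ 2 ≤ (-r x + ε * b x) ^ 2
  nlinarith [sq_nonneg (r x - 2 * (ε * b x))]

lemma ae_eq_zero_of_integral_sq (hr : MemLp r 2 ν) (h : ∫ x, r x ^ 2 ∂ν = 0) : r =ᵐ[ν] 0 := by
  have h1 := (integral_eq_zero_iff_of_nonneg (fun x => sq_nonneg (r x)) hr.integrable_sq).1 h
  filter_upwards [h1] with x hx
  exact pow_eq_zero_iff (two_ne_zero) |>.1 hx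

end Scalar

/-- The algebraic core of the stability estimate. -/
lemma stability_arith {X Z W Y G m α κ CI cLow T : ℝ} (hX : 0 ≤ X) (hZ : 0 ≤ Z) (hW : 0 ≤ W)
    (hY : 0 ≤ Y) (hα : 0 < α) (hα1 : α ≤ 1) (hCI : α * CI ≤ 1 / 4)
    (hG : G ≤ CI * X) (hκ : κ ≤ √α) (hm : 0 ≤ m)
    (hm2 : m ^ 2 ≤ 7 / 6 * Y + 7 * (1 / 16) ^ 2 * W)
    (hT : X + cLow * Z + 1 / 16 * W -
      α * ((1 + 1 / 16) * G - (1 - 1 / 16) * Y + 1 / 16 / 2 * W) - κ * √X * m ≤ T) :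
    min (1 / 100) (min cLow (α / 16)) * (X + Z + W + Y) ≤ T := by
  -- The coefficient `3/4` is such that `3/4 · 7/6 = 7/8` stays below `15/16`, the share of `α Y`
  -- delivered by the stabilization.
  have h1 : κ * √X * m ≤ X / 3 + 3 / 4 * α * m ^ 2 := by
    have e1 : κ * √X * m ≤ √α * √X * m := by gcongr
    have e2 := sq_nonneg (√X / 3 - √α * m / 2)
    have e3 := Real.sq_sqrt hX
    have e4 := Real.sq_sqrt hα.le
    nlinarith
  have h2 : α * G ≤ X / 4 := by
    calc α * G ≤ α * (CI * X) := by gcongr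
      _ = (α * CI) * X := by ring
      _ ≤ 1 / 4 * X := by gcongr
      _ = _ := by ring
  have h3 : α * m ^ 2 ≤ α * (7 / 6 * Y) + 7 * (1 / 16) ^ 2 * W := by
    have : α * m ^ 2 ≤ α * (7 / 6 * Y + 7 * (1 / 16) ^ 2 * W) := by gcongr
    nlinarith [mul_nonneg (sub_nonneg.2 hα1) hW]
  have h4 : α * W ≤ W := by nlinarith
  -- What is left: for `X`, `1 - 17/64 - 1/3`; for `W`, at least `1/16 - 1/32 - 21/1024 = 11/1024`;
  -- both exceed `1/100`. For `Z` there remains `cLow`, and for `Y`, `α (15/16 - 7/8) = α/16`.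
  set c := min (1 / 100) (min cLow (α / 16)) with hc
  have c1 : c ≤ 1 / 100 := min_le_left _ _
  have c2 : c ≤ cLow := (min_le_right _ _).trans (min_le_left _ _)
  have c3 : c ≤ α / 16 := (min_le_right _ _).trans (min_le_right _ _)
  have d1 := mul_le_mul_of_nonneg_right c1 hX
  have d2 := mul_le_mul_of_nonneg_right c2 hZ
  have d3 := mul_le_mul_of_nonneg_right c1 hW
  have d4 := mul_le_mul_of_nonneg_right c3 hY
  nlinarith

/-! ### The test multiplier and the stability estimate -/

namespace Mesh

variable {n : ℕ} {M : Mesh n}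

/-- The square of the broken seminorm of `u - Π^∇ u`. -/
def remSq (M : Mesh n) (k : ℕ) (u : E (n + 1) → ℝ) : ℝ :=
  ∑ K, M.semiSq K (u - polyFun (M.ellProj k K u))

/-- The boundary part of the square of `‖u‖_{1,h}`. -/
def bdSq (M : Mesh n) (k' : ℕ) (u : E (n + 1) → ℝ) : ℝ :=
  ∑ f ∈ M.bdFaces, (M.hFace f)⁻¹ * ∫ y in M.faceDom f, polyFun (M.faceProj k' f u) y ^ 2

lemma semiSq_nonneg (K : Fin M.numElt) (v : E (n + 1) → ℝ) : 0 ≤ M.semiSq K v :=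
  integral_nonneg fun _ => by positivity

lemma remSq_nonneg (k : ℕ) (u : E (n + 1) → ℝ) : 0 ≤ M.remSq k u :=
  Finset.sum_nonneg fun _ _ => semiSq_nonneg _ _

lemma bdSq_nonneg (hT : M.IsTessellation) (k' : ℕ) (u : E (n + 1) → ℝ) : 0 ≤ M.bdSq k' u :=
  Finset.sum_nonneg fun f _ => mul_nonneg (inv_nonneg.2 (hT.hFace_pos f).le)
    (integral_nonneg fun _ => by positivity)

lemma sq_seminormOne (hT : M.IsTessellation) {k : ℕ} {B : Fin M.numFace → NestedBases n k}
    {u : E (n + 1) → ℝ} (hu : u ∈ M.spaceV k B) :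
    M.seminormOne u ^ 2 = M.projSq k u + M.remSq k u := by
  rw [seminormOne, Real.sq_sqrt (Finset.sum_nonneg fun _ _ => semiSq_nonneg _ _), projSq, remSq,
    ← Finset.sum_add_distrib]
  exact Finset.sum_congr rfl fun K _ =>
    hT.semiSq_eq_add (hu.2 K).1 (hT.isEllProj_ellProj k K (hu.2 K).1)

lemma normOne_eq (hT : M.IsTessellation) {k : ℕ} {B : Fin M.numFace → NestedBases n k}
    {u : E (n + 1) → ℝ} (hu : u ∈ M.spaceV k B) (k' : ℕ) :
    M.normOne k' u = √(M.projSq k u + M.remSq k u + M.bdSq k' u) := by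
  rw [normOne, sq_seminormOne hT hu, bdSq]

lemma le_formA_self (hT : M.IsTessellation) {k : ℕ} {B : Fin M.numFace → NestedBases n k}
    {cLow cUp : ℝ} {S : Fin M.numElt → LinearMap.BilinForm ℝ (E (n + 1) → ℝ)}
    (hS : M.IsStabilization k B cLow cUp S) {u : E (n + 1) → ℝ} (hu : u ∈ M.spaceV k B) :
    M.projSq k u + cLow * M.remSq k u ≤ M.formA k S u u := by
  rw [projSq, remSq, formA, Finset.mul_sum, ← Finset.sum_add_distrib]
  refine Finset.sum_le_sum fun K _ => ?_
  have hp := hT.isEllProj_ellProj k K (hu.2 K).1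
  simp only [real_inner_self_eq_norm_sq]
  gcongr
  exact (hS.bounds K _ (hT.inEltSpace_sub (hu.2 K) hp.1)
    (hT.isEllProj_sub (hu.2 K).1 (hu.2 K).2.2.1 hp)).1

lemma faceProj_mem (k' : ℕ) (f : Fin M.numFace) (v : E (n + 1) → ℝ) :
    M.faceProj k' f v ∈ polyDeg n k' := by
  rw [faceProj]
  split_ifs with h
  · exact h.choose_spec.1
  · exact Submodule.zero_mem _

/-- This is the projection property tested with the projection itself. Should no projection exist,
the default value `0` makes both sides vanish, so existence need not be settled. -/
lemma integral_mul_faceProj (k' : ℕ) (f : Fin M.numFace) (v : E (n + 1) → ℝ) :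
    ∫ y in M.faceDom f, v (M.faceParam f y) * polyFun (M.faceProj k' f v) y =
      ∫ y in M.faceDom f, polyFun (M.faceProj k' f v) y ^ 2 := by
  by_cases h : ∃ p, M.IsFaceProj k' f v p
  · have hp : M.IsFaceProj k' f v (M.faceProj k' f v) := by
      rw [faceProj, dif_pos h]
      exact h.choose_spec
    rw [← hp.2 _ hp.1]
    simp only [sq]
  · have h0 : M.faceProj k' f v = 0 := by rw [faceProj, dif_neg h]
    simp [h0]

/-- A multiplier may be prescribed freely on each face. -/
lemma exists_multiplier (hT : M.IsTessellation) (q : Fin M.numFace → MvPolynomial (Fin n) ℝ) :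
    ∃ μ : E (n + 1) → ℝ, ∀ f, ∀ y ∈ M.faceDom f, μ (M.faceParam f y) = polyFun (q f) y := by
  classical
  refine ⟨fun x => if h : ∃ f, ∃ y ∈ M.faceDom f, M.faceParam f y = x then
    polyFun (q h.choose) h.choose_spec.choose else 0, fun f y hy => ?_⟩
  -- Open faces are disjoint and their parametrizations injective, so the chosen face and parameter
  -- point do not matter.
  have key : ∀ f', ∀ y' ∈ M.faceDom f', M.faceParam f' y' = M.faceParam f y →
      polyFun (q f') y' = polyFun (q f) y := by
    intro f' y' hy' he
    have hf : f' = f := by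
      by_contra hne
      exact Set.disjoint_left.1 (hT.face_disjoint _ _ hne) ⟨y', hy', rfl⟩ ⟨y, hy, he.symm⟩
    subst hf
    rw [(M.faceParam f').injective he]
  have h : ∃ f', ∃ y' ∈ M.faceDom f', M.faceParam f' y' = M.faceParam f y := ⟨f, y, hy, rfl⟩
  simp only [dif_pos h]
  exact key _ _ h.choose_spec.choose_spec.1 h.choose_spec.choose_spec.2

lemma memLp_normalDeriv (hT : M.IsTessellation) (k : ℕ) (f : Fin M.numFace) (u : E (n + 1) → ℝ) :
    MemLp (fun y => M.normalDeriv k f u (M.faceParam f y)) 2 (volume.restrict (M.faceDom f)) :=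
  (((continuous_gradient_polyFun _).inner continuous_const).comp
    (M.faceParam f).isometry.continuous).memLp_restrict (hT.isBounded_faceDom f) 2

/-- The multiplier `-λ + ε h⁻¹ Π⁰ u`. -/
def IsTestMultiplier (M : Mesh n) (k' : ℕ) (ε : ℝ) (u lam μ : E (n + 1) → ℝ) : Prop :=
  ∀ f ∈ M.bdFaces, ∀ y ∈ M.faceDom f, μ (M.faceParam f y) =
    -lam (M.faceParam f y) + ε * ((M.hFace f)⁻¹ * polyFun (M.faceProj k' f u) y)

lemma exists_isTestMultiplier (hT : M.IsTessellation) {k' : ℕ} (ε : ℝ) (u : E (n + 1) → ℝ)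
    {lam : E (n + 1) → ℝ} (hlam : lam ∈ M.spaceΛ k') :
    ∃ μ ∈ M.spaceΛ k', M.IsTestMultiplier k' ε u lam μ := by
  classical
  have hr : ∀ f, ∃ r ∈ polyDeg n k', f ∈ M.bdFaces →
      ∀ y ∈ M.faceDom f, lam (M.faceParam f y) = polyFun r y := by
    intro f
    by_cases hf : f ∈ M.bdFaces
    · obtain ⟨r, hr, h⟩ := hlam f hf
      exact ⟨r, hr, fun _ => h⟩
    · exact ⟨0, Submodule.zero_mem _, fun h => (hf h).elim⟩
  choose r hrdeg hr using hr
  obtain ⟨μ, hμ⟩ := exists_multiplier hT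
    fun f => -r f + (ε * (M.hFace f)⁻¹) • M.faceProj k' f u
  refine ⟨μ, fun f _ => ⟨_, Submodule.add_mem _ (Submodule.neg_mem _ (hrdeg f))
    (Submodule.smul_mem _ _ (faceProj_mem k' f u)), hμ f⟩, fun f hf y hy => ?_⟩
  rw [hμ f y hy, hr f hf y hy]
  simp [mul_assoc]

section TestMultiplier

variable {k' : ℕ} {ε : ℝ} {u lam μ : E (n + 1) → ℝ}

lemma memLp_scaled_faceProj (hT : M.IsTessellation) (k' : ℕ) (f : Fin M.numFace)
    (u : E (n + 1) → ℝ) : MemLp (fun y => (M.hFace f)⁻¹ * polyFun (M.faceProj k' f u) y) 2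
      (volume.restrict (M.faceDom f)) :=
  ((continuous_polyFun _).memLp_restrict (hT.isBounded_faceDom f) 2).const_mul _

lemma sum_scaled_faceProj (hT : M.IsTessellation) (k' : ℕ) (u : E (n + 1) → ℝ) :
    ∑ f ∈ M.bdFaces, M.hFace f * ∫ y in M.faceDom f,
      ((M.hFace f)⁻¹ * polyFun (M.faceProj k' f u) y) ^ 2 = M.bdSq k' u := by
  refine Finset.sum_congr rfl fun f _ => ?_
  have := (hT.hFace_pos f).ne'
  simp only [mul_pow]
  rw [integral_const_mul]
  field_simp

lemma IsTestMultiplier.intFace_sq (hμt : M.IsTestMultiplier k' ε u lam μ)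
    (hT : M.IsTessellation) {f : Fin M.numFace} (hf : f ∈ M.bdFaces) :
    (M.intFace f fun x => μ x ^ 2) = ∫ y in M.faceDom f, (-lam (M.faceParam f y) +
      ε * ((M.hFace f)⁻¹ * polyFun (M.faceProj k' f u) y)) ^ 2 :=
  setIntegral_congr_fun (hT.face_open f).measurableSet fun y hy => by
    simp only [hμt f hf y hy]

lemma IsTestMultiplier.sq_normNegHalf_le (hμt : M.IsTestMultiplier k' ε u lam μ)
    (hT : M.IsTessellation) (hlam : lam ∈ M.spaceΛ k') :
    M.normNegHalf μ ^ 2 ≤ 7 / 6 * M.normNegHalf lam ^ 2 + 7 * ε ^ 2 * M.bdSq k' u := by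
  rw [sq_normNegHalf hT, sq_normNegHalf hT, ← sum_scaled_faceProj hT, Finset.mul_sum,
    Finset.mul_sum, ← Finset.sum_add_distrib]
  refine Finset.sum_le_sum fun f hf => ?_
  rw [hμt.intFace_sq hT hf]
  have h := integral_sq_le (memLp_of_mem_spaceΛ hT hlam hf 2) (memLp_scaled_faceProj hT k' f u) ε
  refine (mul_le_mul_of_nonneg_left h (hT.hFace_pos f).le).trans (le_of_eq ?_)
  rw [intFace]
  ring

lemma IsTestMultiplier.le_sq_normNegHalf (hμt : M.IsTestMultiplier k' ε u lam μ)
    (hT : M.IsTessellation) (hlam : lam ∈ M.spaceΛ k') :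
    1 / 2 * M.normNegHalf lam ^ 2 - ε ^ 2 * M.bdSq k' u ≤ M.normNegHalf μ ^ 2 := by
  rw [sq_normNegHalf hT, sq_normNegHalf hT, ← sum_scaled_faceProj hT, Finset.mul_sum,
    Finset.mul_sum, ← Finset.sum_sub_distrib]
  refine Finset.sum_le_sum fun f hf => ?_
  rw [hμt.intFace_sq hT hf]
  have h := le_integral_sq (memLp_of_mem_spaceΛ hT hlam hf 2) (memLp_scaled_faceProj hT k' f u) ε
  refine (le_of_eq ?_).trans (mul_le_mul_of_nonneg_left h (hT.hFace_pos f).le)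
  rw [intFace]
  ring

lemma memLp_spaceV_face (hT : M.IsTessellation) {k : ℕ} {B : Fin M.numFace → NestedBases n k}
    (hu : u ∈ M.spaceV k B) (f : Fin M.numFace) :
    MemLp (fun y => u (M.faceParam f y)) 2 (volume.restrict (M.faceDom f)) :=
  hT.memLp_face (hu.2 (M.adj f)).2.2.1 (hT.adj_mem f) 2

/-- Since `v = u`, the contribution `-λ` of the multiplier cancels the pairing of `λ` with `u`; the
remaining term is evaluated by `integral_mul_faceProj`. -/
lemma IsTestMultiplier.pairing (hμt : M.IsTestMultiplier k' ε u lam μ)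
    (hT : M.IsTessellation) {k : ℕ} {B : Fin M.numFace → NestedBases n k}
    (hu : u ∈ M.spaceV k B) (hlam : lam ∈ M.spaceΛ k') (hμ : μ ∈ M.spaceΛ k') :
    ∑ f ∈ M.bdFaces, M.intFace f (fun x => lam x * u x) +
      ∑ f ∈ M.bdFaces, M.intFace f (fun x => μ x * u x) = ε * M.bdSq k' u := by
  rw [bdSq, Finset.mul_sum, ← Finset.sum_add_distrib]
  refine Finset.sum_congr rfl fun f hf => ?_
  have hu2 := memLp_spaceV_face hT hu f
  have i1 : Integrable (fun y => lam (M.faceParam f y) * u (M.faceParam f y))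
    (volume.restrict (M.faceDom f)) := (memLp_of_mem_spaceΛ hT hlam hf 2).integrable_mul hu2
  have i2 : Integrable (fun y => μ (M.faceParam f y) * u (M.faceParam f y))
    (volume.restrict (M.faceDom f)) := (memLp_of_mem_spaceΛ hT hμ hf 2).integrable_mul hu2
  rw [intFace, intFace, ← integral_add i1 i2, ← integral_mul_faceProj, ← mul_assoc,
    ← integral_const_mul]
  refine setIntegral_congr_fun (hT.face_open f).measurableSet fun y hy => ?_
  simp only [hμt f hf y hy]
  ring

lemma IsTestMultiplier.stabilization_le (hμt : M.IsTestMultiplier k' ε u lam μ)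
    (hT : M.IsTessellation) (hε : 0 ≤ ε) (k : ℕ) (hlam : lam ∈ M.spaceΛ k') :
    ∑ f ∈ M.bdFaces, M.hFace f * M.intFace f (fun x =>
      (lam x + M.normalDeriv k f u x) * (μ x + M.normalDeriv k f u x)) ≤
    (1 + ε) * (∑ f ∈ M.bdFaces, M.hFace f * M.intFace f (fun x => M.normalDeriv k f u x ^ 2)) -
      (1 - ε) * M.normNegHalf lam ^ 2 + ε / 2 * M.bdSq k' u := by
  rw [sq_normNegHalf hT, ← sum_scaled_faceProj hT, Finset.mul_sum,
    Finset.mul_sum, Finset.mul_sum, ← Finset.sum_sub_distrib, ← Finset.sum_add_distrib]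
  refine Finset.sum_le_sum fun f hf => ?_
  have h := integral_stabilization_le (memLp_of_mem_spaceΛ hT hlam hf 2)
    (memLp_normalDeriv hT k f u) (memLp_scaled_faceProj hT k' f u) hε
  have e : M.intFace f (fun x => (lam x + M.normalDeriv k f u x) * (μ x + M.normalDeriv k f u x)) =
      ∫ y in M.faceDom f, (lam (M.faceParam f y) + M.normalDeriv k f u (M.faceParam f y)) *
        (-lam (M.faceParam f y) + ε * ((M.hFace f)⁻¹ * polyFun (M.faceProj k' f u) y) +
          M.normalDeriv k f u (M.faceParam f y)) :=
    setIntegral_congr_fun (hT.face_open f).measurableSet fun y hy => by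
      simp only [hμt f hf y hy]
  rw [e]
  refine (mul_le_mul_of_nonneg_left h (hT.hFace_pos f).le).trans (le_of_eq ?_)
  simp only [intFace]
  ring

end TestMultiplier

/-- The case of vanishing data: some constant multiplier gives a nonnegative value. -/
lemma exists_nonneg_of_zero (hT : M.IsTessellation) {k : ℕ}
    {S : Fin M.numElt → LinearMap.BilinForm ℝ (E (n + 1) → ℝ)} {u lam : E (n + 1) → ℝ} {k' : ℕ}
    (α : ℝ) (hlam : lam ∈ M.spaceΛ k') (hA : 0 ≤ M.formA k S u u) (hlam0 : M.normNegHalf lam ^ 2 = 0)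
    (hG : ∑ f ∈ M.bdFaces, M.hFace f * M.intFace f (fun x => M.normalDeriv k f u x ^ 2) ≤ 0) :
    ∃ μ ∈ M.spaceΛ k', 0 < M.normNegHalf μ ∧ 0 ≤ M.formBH k S α u lam u μ := by
  have hzero : ∀ {w : Fin M.numFace → E (n + 1) → ℝ},
      ∑ f ∈ M.bdFaces, M.hFace f * M.intFace f (fun x => w f x ^ 2) ≤ 0 → ∀ f ∈ M.bdFaces,
      ∫ y in M.faceDom f, w f (M.faceParam f y) ^ 2 = 0 := by
    intro w hw f hf
    have hnn : ∀ f ∈ M.bdFaces, 0 ≤ M.hFace f * M.intFace f (fun x => w f x ^ 2) := fun f _ =>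
      mul_nonneg (hT.hFace_pos f).le (integral_nonneg fun _ => by positivity)
    have := (Finset.sum_eq_zero_iff_of_nonneg hnn).1 (le_antisymm hw (Finset.sum_nonneg hnn)) f hf
    exact (mul_eq_zero.1 this).resolve_left (hT.hFace_pos f).ne'
  have hl : ∀ f ∈ M.bdFaces, (fun y => lam (M.faceParam f y)) =ᵐ[volume.restrict (M.faceDom f)] 0 :=
    fun f hf => ae_eq_zero_of_integral_sq (memLp_of_mem_spaceΛ hT hlam hf 2)
      (hzero (w := fun _ => lam) (by rw [← sq_normNegHalf hT, hlam0]) f hf)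
  have hg : ∀ f ∈ M.bdFaces, (fun y => M.normalDeriv k f u (M.faceParam f y))
      =ᵐ[volume.restrict (M.faceDom f)] 0 :=
    fun f hf => ae_eq_zero_of_integral_sq (memLp_normalDeriv hT k f u) (hzero hG f hf)
  -- Since `λ` and `∂_ν Π^∇ u` vanish almost everywhere on the boundary faces, the form depends on
  -- `μ` only through its pairing with `u`.
  have hform : ∀ μ : E (n + 1) → ℝ, M.formBH k S α u lam u μ =
      M.formA k S u u + ∑ f ∈ M.bdFaces, M.intFace f (fun x => μ x * u x) := by
    intro μ
    have h1 : ∑ f ∈ M.bdFaces, M.intFace f (fun x => lam x * u x) = 0 :=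
      Finset.sum_eq_zero fun f hf => integral_eq_zero_of_ae (by
        filter_upwards [hl f hf] with y hy
        simp only [Pi.zero_apply] at hy ⊢
        rw [hy, zero_mul])
    have h2 : ∑ f ∈ M.bdFaces, M.hFace f * M.intFace f (fun x =>
        (lam x + M.normalDeriv k f u x) * (μ x + M.normalDeriv k f u x)) = 0 :=
      Finset.sum_eq_zero fun f hf => by
        rw [intFace, integral_eq_zero_of_ae, mul_zero]
        filter_upwards [hl f hf, hg f hf] with y hy hy'
        simp only [Pi.zero_apply] at hy hy' ⊢
        rw [hy, hy', add_zero, zero_mul]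
    rw [formBH, h1, h2]
    ring
  have hconst : ∀ s : ℝ, (fun _ : E (n + 1) => s) ∈ M.spaceΛ k' := fun s f _ =>
    ⟨MvPolynomial.C s, C_mem_polyDeg s k', fun y _ => by simp⟩
  have hnorm : ∀ s : ℝ, s ^ 2 = 1 → 0 < M.normNegHalf fun _ => s := by
    intro s hs
    refine Real.sqrt_pos.2 (Finset.sum_pos (fun f _ => mul_pos (hT.hFace_pos f) ?_)
      hT.bdFaces_nonempty)
    simp only [intFace, hs]
    simpa using hT.faceDom_area_pos f
  -- Choosing the constant `1` or `-1` by the sign of `∫ u` avoids having to prove that `u` vanishes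
  -- on the boundary.
  rcases le_total 0 (∑ f ∈ M.bdFaces, M.intFace f u) with h | h
  · refine ⟨fun _ => 1, hconst 1, hnorm 1 (by norm_num), ?_⟩
    rw [hform]
    simp only [one_mul]
    exact add_nonneg hA h
  · refine ⟨fun _ => -1, hconst (-1), hnorm (-1) (by norm_num), ?_⟩
    rw [hform]
    have : ∀ f, M.intFace f (fun x => -1 * u x) = - M.intFace f u := fun f => by
      simp only [intFace, neg_mul, one_mul, integral_neg]
    simp only [this, Finset.sum_neg_distrib]
    linarith

/-- Stability for one pair of data: a test pair realizing the lower bound. -/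
lemma exists_test_pair (hT : M.IsTessellation) {k kStar k' : ℕ}
    {B : Fin M.numFace → NestedBases n k} {cLow cUp : ℝ}
    {S : Fin M.numElt → LinearMap.BilinForm ℝ (E (n + 1) → ℝ)}
    (hS : M.IsStabilization k B cLow cUp S) {Ω : Set (E (n + 1))}
    {σ : Fin M.numFace → E (n + 1)} {α κ CI : ℝ} (hα : 0 < α) (hα1 : α ≤ 1)
    (hCI : α * CI ≤ 1 / 4) (hκ : κ ≤ √α) (hcLow : 0 < cLow)
    {u lam : E (n + 1) → ℝ} (hu : u ∈ M.spaceV k B) (hlam : lam ∈ M.spaceΛ k')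
    (hG : ∑ f ∈ M.bdFaces, M.hFace f * M.intFace f (fun x => M.normalDeriv k f u x ^ 2) ≤
      CI * M.projSq k u)
    (hC : ∀ μ ∈ M.spaceΛ k', |M.formC k kStar Ω σ u μ| ≤
      κ * √(M.projSq k u) * M.normNegHalf μ) :
    ∃ μ ∈ M.spaceΛ k', 0 < M.normOne k' u + M.normNegHalf μ ∧
      min (1 / 100) (min cLow (α / 16)) / 6 * (M.normOne k' u + M.normNegHalf lam) *
        (M.normOne k' u + M.normNegHalf μ) ≤
      M.formBH k S α u lam u μ + M.formC k kStar Ω σ u μ := by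
  have hX := projSq_nonneg (M := M) k u
  have hZ := remSq_nonneg (M := M) k u
  have hW := bdSq_nonneg hT k' u
  have hY : 0 ≤ M.normNegHalf lam ^ 2 := sq_nonneg _
  have hlam0 : 0 ≤ M.normNegHalf lam := Real.sqrt_nonneg _
  have hfA := le_formA_self hT hS hu
  have hN := normOne_eq hT hu k'
  set X := M.projSq k u
  set Z := M.remSq k u
  set W := M.bdSq k' u
  set c := min (1 / 100) (min cLow (α / 16))
  have hc : 0 < c := lt_min (by norm_num) (lt_min hcLow (by positivity))
  -- For data of norm zero the claimed lower bound is `0`, but `-λ + ε h⁻¹ Π⁰ u` then has norm zero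
  -- and is not admissible.
  rcases (add_nonneg (add_nonneg (add_nonneg hX hZ) hW) hY).eq_or_lt with h0 | hpos
  · have hX0 : X = 0 := by linarith
    have hZ0 : Z = 0 := by linarith
    have hW0 : W = 0 := by linarith
    have hY0 : M.normNegHalf lam ^ 2 = 0 := by linarith
    have hN0 : M.normOne k' u = 0 := by rw [hN, hX0, hZ0, hW0]; simp
    obtain ⟨μ, hμ, hμpos, hform⟩ := exists_nonneg_of_zero (S := S) (u := u) hT α hlam
      (by rw [hX0, hZ0] at hfA; simpa using hfA) hY0 (by rw [hX0, mul_zero] at hG; exact hG)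
    refine ⟨μ, hμ, by rw [hN0]; simpa using hμpos, ?_⟩
    have h1 := hC μ hμ
    rw [hX0, Real.sqrt_zero, mul_zero, zero_mul] at h1
    have h2 : M.formC k kStar Ω σ u μ = 0 := abs_eq_zero.1 (le_antisymm h1 (abs_nonneg _))
    rw [hN0, pow_eq_zero_iff two_ne_zero |>.1 hY0, h2]
    simpa using hform
  obtain ⟨μ, hμ, hμt⟩ := exists_isTestMultiplier hT (1 / 16) u hlam
  have hm0 : 0 ≤ M.normNegHalf μ := Real.sqrt_nonneg _
  have hm := hμt.sq_normNegHalf_le hT hlam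
  have hm' := hμt.le_sq_normNegHalf hT hlam
  have hpair := hμt.pairing hT hu hlam hμ
  have hstab := hμt.stabilization_le hT (by norm_num) k hlam
  have hCμ := (abs_le.1 (hC μ hμ)).1
  have hT' : c * (X + Z + W + M.normNegHalf lam ^ 2) ≤
      M.formBH k S α u lam u μ + M.formC k kStar Ω σ u μ := by
    refine stability_arith hX hZ hW hY hα hα1 hCI hG hκ hm0 hm ?_
    have hstab' := mul_le_mul_of_nonneg_left hstab hα.le
    rw [formBH]
    linarith
  have hR := Real.sq_sqrt hpos.le
  set R := √(X + Z + W + M.normNegHalf lam ^ 2)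
  have hR0 : 0 < R := Real.sqrt_pos.2 hpos
  have hN0 : 0 ≤ M.normOne k' u := Real.sqrt_nonneg _
  have hNsq : M.normOne k' u ^ 2 = X + Z + W := by rw [hN, Real.sq_sqrt (by positivity)]
  have b1 : M.normOne k' u ≤ R := abs_le_of_sq_le_sq' (by linarith) hR0.le |>.2
  have b2 : M.normNegHalf lam ≤ R := abs_le_of_sq_le_sq' (by linarith) hR0.le |>.2
  -- Both coefficients `7/6` and `7/256` are below `4`. With `b1` and `b2` the product of norms is
  -- at most `2R · 3R = 6R²`, whence the divisor `6`.
  have b3 : M.normNegHalf μ ≤ 2 * R :=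
    abs_le_of_sq_le_sq' (by rw [mul_pow, hR]; linarith) (by positivity) |>.2
  refine ⟨μ, hμ, ?_, ?_⟩
  · by_contra hneg
    have z1 : M.normOne k' u = 0 := by linarith
    have z2 : M.normNegHalf μ = 0 := by linarith
    rw [z1] at hNsq
    rw [z2] at hm'
    linarith
  · calc _ ≤ c / 6 * (R + R) * (R + 2 * R) := by gcongr
      _ = c * R ^ 2 := by ring
      _ ≤ _ := by rw [hR]; exact hT'

end Mesh

end VEM

end
-- The main theorem
theorem mainTheorem7 (n : ℕ) (hn : n = 1 ∨ n = 2) (k : ℕ) (hk : 1 ≤ k)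
    (γ₀ : ℝ) (hγ₀ : 0 < γ₀) (N₀ : ℕ) :
    ∃ C α₀ : ℝ, 0 < C ∧ 0 < α₀ ∧ α₀ ≤ 1 ∧
      (∀ τ : ℝ, 0 < τ → τ < 1 →
        ∀ (M : VEM.Mesh n) (B : Fin M.numFace → VEM.NestedBases n k)
          (Ω : Set (VEM.E (n + 1))) (σ : Fin M.numFace → VEM.E (n + 1)) (k' kStar : ℕ),
          M.IsTessellation → M.ShapeRegular γ₀ N₀ → M.IsApproximation Ω σ τ →
          (k' = k ∨ k' + 1 = k) → kStar ≤ k →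
          ∀ u ∈ M.spaceV k B, ∀ μ ∈ M.spaceΛ k',
            M.formC k kStar Ω σ u μ ≤ C * τ * M.seminormOne u * M.normNegHalf μ) ∧
      (∀ α : ℝ, 0 < α → α < α₀ →
        0 < (√α - α) / C ∧
        ∀ τ : ℝ, 0 < τ → τ < 1 → τ < (√α - α) / C →
        ∀ cLow cUp : ℝ, 0 < cLow → 0 < cUp →
        ∃ c : ℝ, 0 < c ∧
          ∀ (M : VEM.Mesh n) (B : Fin M.numFace → VEM.NestedBases n k)
            (S : Fin M.numElt → LinearMap.BilinForm ℝ (VEM.E (n + 1) → ℝ))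
            (Ω : Set (VEM.E (n + 1))) (σ : Fin M.numFace → VEM.E (n + 1)) (k' kStar : ℕ),
            M.IsTessellation → M.ShapeRegular γ₀ N₀ → M.IsStabilization k B cLow cUp S →
            M.IsApproximation Ω σ τ → (k' = k ∨ k' + 1 = k) → kStar ≤ k →
            ∀ u ∈ M.spaceV k B, ∀ lam ∈ M.spaceΛ k',
              ((c * (M.normOne k' u + M.normNegHalf lam) : ℝ) : EReal) ≤
                ⨆ v ∈ M.spaceV k B, ⨆ μ ∈ M.spaceΛ k',
                  ⨆ (_ : 0 < M.normOne k' v + M.normNegHalf μ),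
                    (((M.formBH k S α u lam v μ + M.formC k kStar Ω σ u μ) /
                      (M.normOne k' v + M.normNegHalf μ) : ℝ) : EReal)) := by
  obtain ⟨C, hC, hformC⟩ := VEM.Mesh.exists_abs_formC_le n k hγ₀ N₀
  obtain ⟨CI, hCI, hnormal⟩ := VEM.Mesh.exists_normalDeriv_le n k hk hγ₀ N₀
  -- The bound `1 / (4 CI + 4)` forces `α CI ≤ 1/4`, and the summand `4` keeps the denominator
  -- positive if `CI = 0`.
  refine ⟨C, min 1 (1 / (4 * CI + 4)), hC, by positivity, min_le_left _ _, ?_, ?_⟩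
  · intro τ hτ hτ1 M B Ω σ k' kStar hT hS hA _ hks u hu μ hμ
    refine (le_abs_self _).trans ((hformC M Ω σ τ k' kStar hτ hτ1 hT hS hA hks u μ hμ).trans ?_)
    -- The elliptic projection does not increase the broken seminorm, by the Pythagorean splitting.
    have h1 : √(M.projSq k u) ≤ M.seminormOne u := by
      refine Real.sqrt_le_iff.2 ⟨Real.sqrt_nonneg _, ?_⟩
      rw [VEM.Mesh.sq_seminormOne hT hu]
      linarith [VEM.Mesh.remSq_nonneg (M := M) k u]
    have h2 : 0 ≤ M.normNegHalf μ := Real.sqrt_nonneg _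
    gcongr
  · intro α hα hα0
    have hα1 : α < 1 := hα0.trans_le (min_le_left _ _)
    have hαs : α < √α := by
      rw [Real.lt_sqrt hα.le]
      nlinarith
    refine ⟨div_pos (by linarith) hC, fun τ hτ hτ1 hτα cLow cUp hcLow _ =>
      ⟨min (1 / 100) (min cLow (α / 16)) / 6, by positivity, ?_⟩⟩
    intro M B S Ω σ k' kStar hT hS hstab hA _ hks u hu lam hlam
    -- From `τ < τ_α` one has `C τ < √α - α`; stability uses the weaker bound by `√α`.
    have hκ : C * τ ≤ √α := by
      rw [lt_div_iff₀ hC] at hτα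
      linarith
    have hαCI : α * CI ≤ 1 / 4 := by
      have h1 := hα0.le.trans (min_le_right _ _)
      rw [le_div_iff₀ (by positivity)] at h1
      linarith
    obtain ⟨μ, hμ, hpos, hle⟩ := VEM.Mesh.exists_test_pair (kStar := kStar) (Ω := Ω) (σ := σ) hT
      hstab hα hα1.le hαCI hκ hcLow hu hlam (hnormal M hT hS u)
      (fun μ hμ => hformC M Ω σ τ k' kStar hτ hτ1 hT hS hA hks u μ hμ)
    refine le_iSup₂_of_le u hu (le_iSup₂_of_le μ hμ (le_iSup_of_le hpos ?_))
    exact EReal.coe_le_coe_iff.2 ((le_div_iff₀ hpos).2 hle)
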